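/- Notation. For a complex Banach space $X$ with open unit ball $B_X$, let $\mathcal A_u(B_X)$ be the algebra of all holomorphic (complex-analytic), uniformly continuous functions $f\colon B_X\to\mathbb C$, with the supremum norm, and let $\mathcal M(\mathcal A_u(B_X))$ be its spectrum, the set of nonzero (continuous) multiplicative linear functionals. For $\varphi,\psi$ in the spectrum let $\|\varphi-\psi\|$ be the norm in $\mathcal A_u(B_X)^*$ (the Gleason metric), let $$\rho(\varphi,\psi)=\sup\{|\varphi(f)| : f\in\mathcal A_u(B_X),\ \|f\|\le 1,\ \psi(f)=0\}$$ be the pseudo-hyperbolic distance, and let $\mathcal{GP}(\varphi)=\{\psi\in\mathcal M(\mathcal A_u(B_X)) : \rho(\varphi,\psi)<1\}$ be the Gleason part of $\varphi$. For $\lambda$ in the closed unit disc $\overline{\mathbb D}$, $\delta_\lambda$ is evaluation at $\lambda$ of the continuous extension to $\overline{\mathbb D}$ of functions in the disc algebra $\mathcal A(\mathbb D)=\mathcal A_u(B_{\mathbb C})$. For $z$ in the closed unit ball $\overline B_{\ell_\infty}$ of $\ell_\infty=c_0^{**}$, $\delta_z(f)=\tilde f(z)$ for $f\in\mathcal A_u(B_{c_0})$,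 where $\tilde f$ is the canonical extension of $f$ to the bidual: on the open ball $B_{\ell_\infty}$ it is the sum of the Aron–Berner extensions of the homogeneous polynomials in the Taylor series of $f$ at $0$, and it is extended by continuity to $\overline B_{\ell_\infty}$. For $\lambda\in\mathbb D$ and $0<r<1$ let $$\mathcal D_r(\lambda)=\Big\{\mu\in\mathbb D : \Big|\frac{\lambda-\mu}{1-\overline\lambda\mu}\Big|<r\Big\}.$$ Theorem. The functionals $\delta_z$ ($z\in\overline B_{\ell_\infty}$) are well-defined elements of $\mathcal M(\mathcal A_u(B_{c_0}))$, the functionals $\delta_\lambda$ ($\lambda\in\overline{\mathbb D}$) are well-defined elements of $\mathcal M(\mathcal A(\mathbb D))$, and for all $z=(z_n)$ and $w=(w_n)$ in $\overline B_{\ell_\infty}$, $$\|\delta_z-\delta_w\|=\sup_{n\in\mathbb N}\|\delta_{z_n}-\delta_{w_n}\| .$$ Moreover, with $\mathbb N_0=\{n\in\mathbb N : z_n\ne w_n\}$, $$\rho(\delta_z,\delta_w)=\sup_{n\in\mathbb N}\rho(\delta_{z_n},\delta_{w_n})=\sup_{n\in\mathbb N_0}\Big|\frac{z_n-w_n}{1-\overline{z_n}\,w_n}\Big|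 ,$$ where the last supremum is $0$ if $\mathbb N_0=\varnothing$. Hence, for every $z=(z_n)\in\overline B_{\ell_\infty}$, $$\mathcal{GP}(\delta_z)=\bigcup_{0<r<1}\big\{\delta_w : w\in\overline B_{\ell_\infty},\ w_n=z_n\text{ if }|z_n|=1\text{ and } w_n\in\mathcal D_r(z_n)\text{ if }|z_n|<1\big\}.$$ -/

import Mathlib

open Metric Filter Topology
open scoped ZeroAtInfty BoundedContinuousFunction ENNReal lp

noncomputable section

namespace GleasonC0

section Algebra

variable {X : Type*} [NormedAddCommGroup X] [NormedSpace ℂ X]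

/-- A function on the open unit ball of `X`, extended by zero to all of `X`. -/
def ext {X : Type*} [NormedAddCommGroup X] (f : ball (0 : X) 1 → ℂ) : X → ℂ :=
  Function.extend Subtype.val f 0

theorem ext_apply {X : Type*} [NormedAddCommGroup X] (f : ball (0 : X) 1 → ℂ) (x : X) (hx : x ∈ ball (0 : X) 1) :
    ext f x = f ⟨x, hx⟩ :=
  Subtype.val_injective.extend_apply f 0 ⟨x, hx⟩

variable (X) in
/-- The algebra `𝒜ᵤ(B_X)` of holomorphic (complex-analytic), uniformly continuous functions on the
open unit ball of `X`, with the supremum norm.  (A uniformly continuous function on the ball is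
automatically bounded.) -/
def Au : Subalgebra ℂ (ball (0 : X) 1 →ᵇ ℂ) where
  carrier := {f | AnalyticOnNhd ℂ (ext f) (ball (0 : X) 1) ∧ UniformContinuous f}
  mul_mem' := by
    rintro f g ⟨hf, hf'⟩ ⟨hg, hg'⟩
    refine ⟨(hf.mul hg).congr isOpen_ball fun x hx => ?_, ?_⟩
    · simp [ext_apply, hx]
    · rw [Metric.uniformContinuous_iff] at *
      intro ε hε
      have hC : 0 < ‖f‖ + ‖g‖ + 1 := by positivity
      obtain ⟨d₁, hd₁, h₁⟩ := hf' (ε / (‖f‖ + ‖g‖ + 1)) (by positivity)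
      obtain ⟨d₂, hd₂, h₂⟩ := hg' (ε / (‖f‖ + ‖g‖ + 1)) (by positivity)
      refine ⟨min d₁ d₂, lt_min hd₁ hd₂, fun {a b} hab => ?_⟩
      have e₁ := h₁ (lt_of_lt_of_le hab (min_le_left _ _))
      have e₂ := h₂ (lt_of_lt_of_le hab (min_le_right _ _))
      rw [dist_eq_norm] at *
      have e : (f * g) a - (f * g) b = f a * (g a - g b) + (f a - f b) * g b := by
        simp only [BoundedContinuousFunction.mul_apply]; ring
      rw [e]
      calc _ ≤ ‖f a‖ * ‖g a - g b‖ + ‖f a - f b‖ * ‖g b‖ := by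
            refine (norm_add_le _ _).trans ?_
            rw [norm_mul, norm_mul]
        _ ≤ ‖f‖ * (ε / (‖f‖ + ‖g‖ + 1)) + (ε / (‖f‖ + ‖g‖ + 1)) * ‖g‖ := by
            gcongr
            · exact f.norm_coe_le_norm a
            · exact g.norm_coe_le_norm b
        _ < (‖f‖ + ‖g‖ + 1) * (ε / (‖f‖ + ‖g‖ + 1)) := by
            have : 0 < ε / (‖f‖ + ‖g‖ + 1) := by positivity
            nlinarith
        _ = ε := by field_simp
  add_mem' := by
    rintro f g ⟨hf, hf'⟩ ⟨hg, hg'⟩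
    refine ⟨(hf.add hg).congr isOpen_ball fun x hx => ?_, hf'.add hg'⟩
    simp [ext_apply, hx]
  algebraMap_mem' := by
    intro c
    refine ⟨(analyticOnNhd_const (v := c)).congr isOpen_ball fun x hx => ?_, ?_⟩
    · rw [ext_apply _ x hx]; rfl
    · exact uniformContinuous_const (b := c)

/-- The value at a point `x` of the closed unit ball of the continuous extension of `f` to that
closed ball. -/
def evalClosed (f : Au X) (x : X) : ℂ :=
  extendFrom (ball (0 : X) 1) (ext (f : ball (0 : X) 1 →ᵇ ℂ)) x

variable (X) in
/-- The bidual of `X`. -/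
abbrev Bidual : Type _ := StrongDual ℂ (StrongDual ℂ X)

/-- The Aron–Berner extension of continuous multilinear forms `A` on `X` to the bidual of `X`:
`aronBerner m ζ A` is the value at `(ζ₀, …, ζₘ₋₁)` of the extension of `A`, obtained by extending
one variable after the other, see `aronBerner_succ_apply`. -/
def aronBerner : (m : ℕ) → (Fin m → Bidual X) → StrongDual ℂ (X [×m]→L[ℂ] ℂ)
  | 0, _ => ContinuousMultilinearMap.apply ℂ (fun _ : Fin 0 => X) ℂ 0
  | m + 1, ζ =>
      ((ζ 0).comp (ContinuousLinearMap.compL ℂ X (X [×m]→L[ℂ] ℂ) ℂ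
        (aronBerner m (Fin.tail ζ)))).comp
        (continuousMultilinearCurryLeftEquiv ℂ (fun _ : Fin (m + 1) => X)
          ℂ).toContinuousLinearEquiv.toContinuousLinearMap

theorem aronBerner_succ_apply (m : ℕ) (ζ : Fin (m + 1) → Bidual X) (A : X [×(m + 1)]→L[ℂ] ℂ) :
    aronBerner (m + 1) ζ A = ζ 0 ((aronBerner m (Fin.tail ζ)).comp A.curryLeft) := rfl

/-- The canonical extension of `f` to the open unit ball of the bidual: the sum of the Aron–Berner
extensions of the homogeneous polynomials in the Taylor series of `f` at the origin. -/
def canonicalExt (f : Au X) (ζ : Bidual X) : ℂ :=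
  ∑' m : ℕ, aronBerner m (fun _ => ζ)
    ((Nat.factorial m : ℂ)⁻¹ • iteratedFDeriv ℂ m (ext (f : ball (0 : X) 1 →ᵇ ℂ)) 0)

/-- The value at a point `ζ` of the closed unit ball of the bidual of the canonical extension of
`f`, extended by continuity from the open ball to the closed ball. -/
def canonicalExtClosed (f : Au X) (ζ : Bidual X) : ℂ :=
  extendFrom (ball (0 : Bidual X) 1) (canonicalExt f) ζ

variable (X) in
/-- The spectrum `ℳ(𝒜ᵤ(B_X))`. -/
abbrev Spec : Type _ := WeakDual.characterSpace ℂ (Au X)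

/-- The Gleason metric `‖φ - ψ‖`, the norm being that of the dual Banach space of `𝒜ᵤ(B_X)`. -/
def gleasonDist (φ ψ : Spec X) : ℝ :=
  ‖WeakDual.toStrongDual (φ : WeakDual ℂ (Au X)) - WeakDual.toStrongDual (ψ : WeakDual ℂ (Au X))‖

/-- The pseudo-hyperbolic distance on the spectrum. -/
def rho (φ ψ : Spec X) : ℝ :=
  sSup {t : ℝ | ∃ f : Au X, ‖f‖ ≤ 1 ∧ ψ f = 0 ∧ t = ‖φ f‖}

/-- The Gleason part of `φ`. -/
def gleasonPart (φ : Spec X) : Set (Spec X) :=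
  {ψ | rho φ ψ < 1}

end Algebra

/-- The pseudo-hyperbolic disc `𝒟ᵣ(a)` in the open unit disc. -/
def pseudoDisc (r : ℝ) (a : ℂ) : Set ℂ :=
  {b | ‖b‖ < 1 ∧ ‖(a - b) / (1 - starRingEnd ℂ a * b)‖ < r}

/-- The unit vector `eₙ` of `c₀ = C₀(ℕ, ℂ)`. -/
def unitVec (n : ℕ) : C₀(ℕ, ℂ) where
  toFun := Pi.single n 1
  continuous_toFun := continuous_of_discreteTopology
  zero_at_infty' := by
    rw [Filter.cocompact_eq_cofinite]
    refine tendsto_const_nhds.congr' ?_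
    filter_upwards [(Set.finite_singleton n).compl_mem_cofinite] with k hk
    have : k ≠ n := by simpa using hk
    simp [Pi.single_eq_of_ne this]

theorem unitVec_apply (n k : ℕ) : unitVec n k = if k = n then 1 else 0 := by
  change Pi.single (M := fun _ : ℕ => ℂ) n 1 k = _
  rw [Pi.single_apply]

theorem sum_norm_unitVec_le (y : StrongDual ℂ C₀(ℕ, ℂ)) (s : Finset ℕ) :
    ∑ n ∈ s, ‖y (unitVec n)‖ ≤ ‖y‖ := by
  have hu : ∀ n : ℕ, ∃ u : ℂ, ‖u‖ ≤ 1 ∧ u * y (unitVec n) = (‖y (unitVec n)‖ : ℂ) := by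
    intro n
    by_cases h : y (unitVec n) = 0
    · exact ⟨0, by simp, by simp [h]⟩
    · have h' : (‖y (unitVec n)‖ : ℂ) ≠ 0 := by simpa using h
      refine ⟨‖y (unitVec n)‖ / y (unitVec n), ?_, by field_simp⟩
      rw [norm_div, Complex.norm_real, norm_norm, div_self (norm_ne_zero_iff.2 h)]
  choose u hu₁ hu₂ using hu
  have e : y (∑ n ∈ s, u n • unitVec n) = ((∑ n ∈ s, ‖y (unitVec n)‖ : ℝ) : ℂ) := by
    simp [map_sum, hu₂]
  have hv : ‖∑ n ∈ s, u n • unitVec n‖ ≤ 1 := by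
    rw [← ZeroAtInftyContinuousMap.norm_toBCF_eq_norm,
      BoundedContinuousFunction.norm_le zero_le_one]
    intro k
    have e' : (∑ n ∈ s, u n • unitVec n) k = ∑ n ∈ s, u n * unitVec n k := by
      classical
      induction s using Finset.induction_on with
      | empty => simp
      | insert a t ha ih => simp_all [Finset.sum_insert ha]
    change ‖(∑ n ∈ s, u n • unitVec n) k‖ ≤ 1
    rw [e']
    simp only [unitVec_apply, mul_ite, mul_one, mul_zero, Finset.sum_ite_eq]
    split_ifs
    · exact hu₁ k
    · simp
  have h₀ : 0 ≤ ∑ n ∈ s, ‖y (unitVec n)‖ := Finset.sum_nonneg fun _ _ => norm_nonneg _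
  calc ∑ n ∈ s, ‖y (unitVec n)‖ = ‖y (∑ n ∈ s, u n • unitVec n)‖ := by
        rw [e, Complex.norm_real, Real.norm_of_nonneg h₀]
    _ ≤ ‖y‖ * ‖∑ n ∈ s, u n • unitVec n‖ := y.le_opNorm _
    _ ≤ ‖y‖ := mul_le_of_le_one_right y.opNorm_nonneg hv

theorem summable_pairing (z : ℓ^∞(ℕ, ℂ)) (y : StrongDual ℂ C₀(ℕ, ℂ)) :
    Summable fun n => ‖z n * y (unitVec n)‖ := by
  have h : Summable fun n => ‖y (unitVec n)‖ :=
    summable_of_sum_le (fun _ => norm_nonneg _) (sum_norm_unitVec_le y)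
  refine (h.mul_left ‖z‖).of_nonneg_of_le (fun _ => norm_nonneg _) fun n => ?_
  rw [norm_mul]
  gcongr
  exact lp.norm_apply_le_norm ENNReal.top_ne_zero z n

/-- The identification of `ℓ_∞` with the bidual of `c₀`: the sequence `z` acts on
`y ∈ c₀* = ℓ₁` by `∑ₙ zₙ y(eₙ)`. -/
def toBidual (z : ℓ^∞(ℕ, ℂ)) : Bidual C₀(ℕ, ℂ) :=
  LinearMap.mkContinuous
    { toFun := fun y => ∑' n, z n * y (unitVec n)
      map_add' := fun y y' => by
        simp only [_root_.add_apply, mul_add]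
        exact (summable_pairing z y).of_norm.tsum_add (summable_pairing z y').of_norm
      map_smul' := fun c y => by
        simp only [_root_.smul_apply, smul_eq_mul, RingHom.id_apply, mul_left_comm]
        exact tsum_mul_left }
    ‖z‖ fun y => by
      have h : Summable fun n => ‖y (unitVec n)‖ :=
        summable_of_sum_le (fun _ => norm_nonneg _) (sum_norm_unitVec_le y)
      refine (norm_tsum_le_tsum_norm (summable_pairing z y)).trans ?_
      refine ((summable_pairing z y).tsum_le_tsum (fun n => ?_) (h.mul_left ‖z‖)).trans ?_
      · rw [norm_mul]
        gcongr
        exact lp.norm_apply_le_norm ENNReal.top_ne_zero z n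
      · rw [tsum_mul_left]
        gcongr
        exact h.tsum_le_of_sum_le (sum_norm_unitVec_le y)

/-- The coordinates of a point of the closed unit ball of `ℓ_∞`, as points of the closed disc. -/
def coord (z : closedBall (0 : ℓ^∞(ℕ, ℂ)) 1) (n : ℕ) : closedBall (0 : ℂ) 1 :=
  ⟨z.1 n, by
    rw [mem_closedBall_zero_iff]
    exact (lp.norm_apply_le_norm ENNReal.top_ne_zero z.1 n).trans
      (mem_closedBall_zero_iff.1 z.2)⟩

end GleasonC0

end

noncomputable section

namespace GleasonC0

section CZero

set_option maxSynthPendingDepth 3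

theorem norm_le_of_forall_apply_le {x : C₀(ℕ, ℂ)} {C : ℝ} (hC : 0 ≤ C) (h : ∀ n, ‖x n‖ ≤ C) :
    ‖x‖ ≤ C := by
  rw [← ZeroAtInftyContinuousMap.norm_toBCF_eq_norm, BoundedContinuousFunction.norm_le hC]
  exact h

theorem norm_apply_le (x : C₀(ℕ, ℂ)) (n : ℕ) : ‖x n‖ ≤ ‖x‖ := by
  rw [← ZeroAtInftyContinuousMap.norm_toBCF_eq_norm]
  exact x.toBCF.norm_coe_le_norm n

/-- The `n`-th coordinate functional on `c₀`. -/
def coordFun (n : ℕ) : StrongDual ℂ C₀(ℕ, ℂ) :=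
  LinearMap.mkContinuous
    { toFun := fun x => x n
      map_add' := fun _ _ => rfl
      map_smul' := fun _ _ => rfl } 1 fun x => by simpa using norm_apply_le x n

@[simp]
theorem coordFun_apply (n : ℕ) (x : C₀(ℕ, ℂ)) : coordFun n x = x n := rfl

theorem norm_coordFun_le (n : ℕ) : ‖coordFun n‖ ≤ 1 :=
  LinearMap.mkContinuous_norm_le _ zero_le_one _

theorem sum_apply {ι : Type*} (s : Finset ι) (v : ι → C₀(ℕ, ℂ)) (k : ℕ) :
    (∑ i ∈ s, v i) k = ∑ i ∈ s, v i k :=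
  map_sum (coordFun k) v s

/-- The projection of `c₀` onto its first `N` coordinates. -/
def proj (N : ℕ) : C₀(ℕ, ℂ) →L[ℂ] C₀(ℕ, ℂ) :=
  ∑ i ∈ Finset.range N, (coordFun i).smulRight (unitVec i)

theorem proj_eq_sum (N : ℕ) (x : C₀(ℕ, ℂ)) :
    proj N x = ∑ i ∈ Finset.range N, x i • unitVec i := by
  simp [proj]

theorem sum_smul_unitVec_apply (N : ℕ) (c : ℕ → ℂ) (k : ℕ) :
    (∑ i ∈ Finset.range N, c i • unitVec i) k = if k < N then c k else 0 := by
  rw [sum_apply]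
  simp [unitVec_apply]

theorem norm_sum_smul_unitVec_le (N : ℕ) {c : ℕ → ℂ} {C : ℝ} (hC : 0 ≤ C)
    (h : ∀ i, i < N → ‖c i‖ ≤ C) : ‖∑ i ∈ Finset.range N, c i • unitVec i‖ ≤ C := by
  refine norm_le_of_forall_apply_le hC fun k => ?_
  rw [sum_smul_unitVec_apply]
  split_ifs with hk
  · exact h k hk
  · simpa using hC

theorem proj_apply (N : ℕ) (x : C₀(ℕ, ℂ)) (k : ℕ) :
    proj N x k = if k < N then x k else 0 := by
  rw [proj_eq_sum, sum_smul_unitVec_apply]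

theorem norm_proj_apply_le (N : ℕ) (x : C₀(ℕ, ℂ)) : ‖proj N x‖ ≤ ‖x‖ := by
  rw [proj_eq_sum]
  exact norm_sum_smul_unitVec_le N (norm_nonneg _) fun i _ => norm_apply_le x i

theorem norm_proj_le (N : ℕ) : ‖proj N‖ ≤ 1 :=
  ContinuousLinearMap.opNorm_le_bound _ zero_le_one fun x => by
    simpa using norm_proj_apply_le N x

theorem norm_proj_sub_proj_le (M N : ℕ) (x : C₀(ℕ, ℂ)) : ‖proj M x - proj N x‖ ≤ ‖x‖ := by
  refine norm_le_of_forall_apply_le (norm_nonneg _) fun k => ?_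
  rw [ZeroAtInftyContinuousMap.sub_apply, proj_apply, proj_apply]
  have := norm_apply_le x k
  split_ifs <;> simp [this]

theorem tendsto_proj (x : C₀(ℕ, ℂ)) : Tendsto (fun N => proj N x) atTop (𝓝 x) := by
  rw [Metric.tendsto_atTop]
  intro ε hε
  have h := x.zero_at_infty'
  rw [Filter.cocompact_eq_cofinite, Nat.cofinite_eq_atTop, Metric.tendsto_atTop] at h
  obtain ⟨K, hK⟩ := h (ε / 2) (by positivity)
  refine ⟨K, fun N hN => ?_⟩
  rw [dist_eq_norm]
  refine lt_of_le_of_lt (norm_le_of_forall_apply_le (C := ε / 2) (by positivity) fun k => ?_)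
    (half_lt_self hε)
  rw [ZeroAtInftyContinuousMap.sub_apply, proj_apply]
  split_ifs with hk
  · simp; positivity
  · have := (hK k (by omega)).le
    rw [dist_zero_right] at this
    simpa using this

/-- A normalized sequence of vectors of `c₀` supported in successive intervals spans its
coefficients isometrically. -/
theorem norm_sum_blocks_le {N : ℕ → ℕ} (hN : Monotone N) {v : ℕ → C₀(ℕ, ℂ)} (hv : ∀ n, ‖v n‖ ≤ 1)
    (hlow : ∀ n k, k < N n → v n k = 0) (hhigh : ∀ n k, N (n + 1) ≤ k → v n k = 0)
    (F : Finset ℕ) {a : ℕ → ℂ} (ha : ∀ n, ‖a n‖ ≤ 1) : ‖∑ n ∈ F, a n • v n‖ ≤ 1 := by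
  refine norm_le_of_forall_apply_le zero_le_one fun k => ?_
  rw [sum_apply]
  by_cases h : ∃ n ∈ F, v n k ≠ 0
  · obtain ⟨n, hn, hk⟩ := h
    have h₁ : N n ≤ k := not_lt.1 fun h => hk (hlow n k h)
    have h₂ : k < N (n + 1) := not_le.1 fun h => hk (hhigh n k h)
    rw [Finset.sum_eq_single n]
    · rw [ZeroAtInftyContinuousMap.smul_apply, smul_eq_mul, norm_mul]
      exact mul_le_one₀ (ha n) (norm_nonneg _) ((norm_apply_le _ _).trans (hv n))
    · intro j _ hj
      rw [ZeroAtInftyContinuousMap.smul_apply]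
      rcases lt_or_gt_of_ne hj with hj | hj
      · rw [hhigh j k ((hN hj).trans h₁), smul_zero]
      · rw [hlow j k (h₂.trans_le (hN hj)), smul_zero]
    · exact fun h => absurd hn h
  · push Not at h
    rw [Finset.sum_eq_zero fun n hn => by
      rw [ZeroAtInftyContinuousMap.smul_apply, h n hn, smul_zero]]
    simp

end CZero

section NoC0

set_option maxSynthPendingDepth 3

variable {E F : Type*} [NormedAddCommGroup E] [NormedSpace ℂ E]
  [NormedAddCommGroup F] [NormedSpace ℂ F]

/-- The series `∑ₖ xₖ` is weakly unconditionally Cauchy, with constant `C`. -/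
def IsWUC (C : ℝ) (x : ℕ → E) : Prop :=
  ∀ (s : Finset ℕ) (a : ℕ → ℂ), (∀ k, ‖a k‖ ≤ 1) → ‖∑ k ∈ s, a k • x k‖ ≤ C

variable (E) in
/-- The terms of every weakly unconditionally Cauchy series in `E` tend to zero. -/
def HasNoC0 : Prop :=
  ∀ (C : ℝ) (x : ℕ → E), IsWUC C x → Tendsto x atTop (𝓝 0)

theorem IsWUC.comp {C : ℝ} {x : ℕ → E} (hx : IsWUC C x) {k : ℕ → ℕ}
    (hk : Function.Injective k) : IsWUC C (x ∘ k) := by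
  intro s a ha
  have := hx (s.map ⟨k, hk⟩) (Function.extend k a 0) fun j => by
    by_cases h : ∃ i, k i = j
    · obtain ⟨i, rfl⟩ := h
      rw [hk.extend_apply]
      exact ha i
    · rw [Function.extend_apply' _ _ _ h]
      simp
  simpa [Finset.sum_map, hk.extend_apply] using this

theorem IsWUC.map {C : ℝ} {x : ℕ → E} (hx : IsWUC C x) (T : E →L[ℂ] F) :
    IsWUC (‖T‖ * C) fun k => T (x k) := by
  intro s a ha
  have : ∑ k ∈ s, a k • T (x k) = T (∑ k ∈ s, a k • x k) := by simp [map_sum]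
  rw [this]
  exact T.le_opNorm_of_le (hx s a ha)

theorem HasNoC0.of_linearIsometry (h : HasNoC0 F) (e : E →ₗᵢ[ℂ] F) : HasNoC0 E := by
  intro C x hx
  have := h _ _ (hx.map e.toContinuousLinearMap)
  rw [tendsto_zero_iff_norm_tendsto_zero] at this ⊢
  simpa using this

theorem hasNoC0_complex : HasNoC0 ℂ := by
  intro C x hx
  refine tendsto_zero_iff_norm_tendsto_zero.2 (Summable.tendsto_atTop_zero ?_)
  refine summable_of_sum_le (c := C) (fun _ => norm_nonneg _) fun s => ?_
  have hu : ∀ n : ℕ, ∃ u : ℂ, ‖u‖ ≤ 1 ∧ u * x n = (‖x n‖ : ℂ) := by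
    intro n
    by_cases h : x n = 0
    · exact ⟨0, by simp, by simp [h]⟩
    · refine ⟨‖x n‖ / x n, ?_, by field_simp⟩
      rw [norm_div, Complex.norm_real, norm_norm, div_self (norm_ne_zero_iff.2 h)]
  choose u hu₁ hu₂ using hu
  have := hx s u hu₁
  simp only [smul_eq_mul, hu₂] at this
  rw [← Complex.ofReal_sum, Complex.norm_real] at this
  exact (le_abs_self _).trans this

/-- A bounded operator from `c₀` into a space without copies of `c₀` is the norm limit of its
restrictions to the first coordinates. -/
theorem HasNoC0.tendsto_comp_proj (hE : HasNoC0 E) (T : C₀(ℕ, ℂ) →L[ℂ] E) :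
    Tendsto (fun N => T.comp (proj N)) atTop (𝓝 T) := by
  by_contra hcon
  rw [Metric.tendsto_atTop] at hcon
  push Not at hcon
  obtain ⟨ε, hε, hcon⟩ := hcon
  have hstep : ∀ N₀ : ℕ, ∃ (M : ℕ) (v : C₀(ℕ, ℂ)), N₀ ≤ M ∧ ‖v‖ ≤ 1 ∧
      (∀ k, k < N₀ → v k = 0) ∧ (∀ k, M ≤ k → v k = 0) ∧ ε / 2 < ‖T v‖ := by
    intro N₀
    obtain ⟨N, hN, hd⟩ := hcon N₀
    rw [dist_comm, dist_eq_norm] at hd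
    obtain ⟨x, hx, hTx⟩ := ContinuousLinearMap.exists_lt_apply_of_lt_opNorm _
      ((half_lt_self hε).trans_le hd)
    have hlim : Tendsto (fun M => ‖T (proj M x - proj N x)‖) atTop
        (𝓝 ‖T (x - proj N x)‖) :=
      ((T.continuous.tendsto _).comp ((tendsto_proj x).sub_const _)).norm
    have hlt : ε / 2 < ‖T (x - proj N x)‖ := by simpa using hTx
    obtain ⟨M, hM, hNM⟩ := ((hlim.eventually_const_lt hlt).and (eventually_ge_atTop N)).exists
    refine ⟨M, _, hN.trans hNM, (norm_proj_sub_proj_le M N x).trans hx.le, ?_, ?_, hM⟩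
    · intro k hk
      rw [ZeroAtInftyContinuousMap.sub_apply, proj_apply, proj_apply, if_pos (by omega),
        if_pos (by omega), sub_self]
    · intro k hk
      rw [ZeroAtInftyContinuousMap.sub_apply, proj_apply, proj_apply, if_neg (by omega),
        if_neg (by omega), sub_self]
  choose M v hM hv hlow hhigh hTv using hstep
  let N : ℕ → ℕ := fun n => M^[n] 0
  have hNs : ∀ n, N (n + 1) = M (N n) := fun n => Function.iterate_succ_apply' M n 0
  have hmono : Monotone N := monotone_nat_of_le_succ fun n => (hNs n).symm ▸ hM (N n)
  have hwuc : IsWUC 1 fun n => v (N n) := fun s a ha =>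
    norm_sum_blocks_le hmono (fun n => hv (N n)) (fun n => hlow (N n))
      (fun n k hk => hhigh (N n) k (hNs n ▸ hk)) s ha
  have hlim := hE _ _ (hwuc.map T)
  obtain ⟨n, hn⟩ := ((tendsto_zero_iff_norm_tendsto_zero.1 hlim).eventually_lt_const
    (half_pos hε)).exists
  exact lt_asymm hn (hTv (N n))

theorem comp_proj_eq_sum (T : C₀(ℕ, ℂ) →L[ℂ] E) (N : ℕ) :
    T.comp (proj N) = ∑ i ∈ Finset.range N, (coordFun i).smulRight (T (unitVec i)) := by
  ext x
  simp [proj_eq_sum, map_sum]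

theorem tendsto_comp_proj_of_pointwise {ι : Type*} {l : Filter ι} {x : ι → C₀(ℕ, ℂ) →L[ℂ] E}
    {T : C₀(ℕ, ℂ) →L[ℂ] E} (h : ∀ u, Tendsto (fun k => x k u) l (𝓝 (T u))) (N : ℕ) :
    Tendsto (fun k => (x k).comp (proj N)) l (𝓝 (T.comp (proj N))) := by
  simp only [comp_proj_eq_sum]
  exact tendsto_finsetSum _ fun i _ =>
    ((ContinuousLinearMap.smulRightL ℂ C₀(ℕ, ℂ) E (coordFun i)).continuous.tendsto _).comp
      (h (unitVec i))

theorem HasNoC0.clm (hE : HasNoC0 E) : HasNoC0 (C₀(ℕ, ℂ) →L[ℂ] E) := by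
  intro C x hx
  by_contra hcon
  rw [Metric.tendsto_atTop] at hcon
  push Not at hcon
  obtain ⟨ε, hε, hcon⟩ := hcon
  simp only [dist_zero_right] at hcon
  have hpt : ∀ u, Tendsto (fun k => x k u) atTop (𝓝 ((0 : C₀(ℕ, ℂ) →L[ℂ] E) u)) := fun u =>
    hE _ _ (hx.map (ContinuousLinearMap.apply ℂ E u))
  have hproj : ∀ N, Tendsto (fun k => ‖(x k).comp (proj N)‖) atTop (𝓝 0) := fun N => by
    simpa using (tendsto_comp_proj_of_pointwise hpt N).norm
  let d : ℕ → ℝ := fun n => ε / 8 * (1 / 2) ^ n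
  have hd : ∀ n, 0 < d n := fun n => by positivity
  have hd' : ∀ n, d n ≤ ε / 8 := fun n =>
    mul_le_of_le_one_right (by positivity) (pow_le_one₀ (by norm_num) (by norm_num))
  have hstep : ∀ (n K N : ℕ), ∃ (k M : ℕ) (u : C₀(ℕ, ℂ)), K < k ∧ N ≤ M ∧ ‖u‖ ≤ 1 ∧
      (∀ i, i < N → u i = 0) ∧ (∀ i, M ≤ i → u i = 0) ∧ ε / 2 < ‖x k u‖ ∧
      ‖(x k).comp (proj N)‖ ≤ d n ∧ ‖x k - (x k).comp (proj M)‖ ≤ d n := by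
    intro n K N
    obtain ⟨K', hK'⟩ := eventually_atTop.1 ((hproj N).eventually_lt_const (hd n))
    obtain ⟨k, hk, hxk⟩ := hcon (max K' (K + 1))
    have h₁ := hK' k ((le_max_left _ _).trans hk)
    obtain ⟨u, hu, hxu⟩ := ContinuousLinearMap.exists_lt_apply_of_lt_opNorm (x k)
      (r := 3 / 4 * ε) (by linarith)
    have hlim : Tendsto (fun M => ‖x k - (x k).comp (proj M)‖) atTop (𝓝 0) := by
      simpa using ((hE.tendsto_comp_proj (x k)).const_sub (x k)).norm
    obtain ⟨M, hM, hNM⟩ := ((hlim.eventually_lt_const (hd n)).and (eventually_ge_atTop N)).exists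
    refine ⟨k, M, proj M u - proj N u, ?_, hNM, (norm_proj_sub_proj_le M N u).trans hu.le,
      ?_, ?_, ?_, h₁.le, hM.le⟩
    · exact (Nat.lt_succ_self K).trans_le ((le_max_right _ _).trans hk)
    · intro i hi
      rw [ZeroAtInftyContinuousMap.sub_apply, proj_apply, proj_apply, if_pos (by omega),
        if_pos (by omega), sub_self]
    · intro i hi
      rw [ZeroAtInftyContinuousMap.sub_apply, proj_apply, proj_apply, if_neg (by omega),
        if_neg (by omega), sub_self]
    · have e : x k u = x k (proj M u - proj N u) + (x k).comp (proj N) u +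
          (x k - (x k).comp (proj M)) u := by
        simp
      have b₁ : ‖(x k).comp (proj N) u‖ ≤ d n :=
        (ContinuousLinearMap.le_of_opNorm_le_of_le _ h₁.le hu.le).trans_eq (mul_one _)
      have b₂ : ‖(x k - (x k).comp (proj M)) u‖ ≤ d n :=
        (ContinuousLinearMap.le_of_opNorm_le_of_le _ hM.le hu.le).trans_eq (mul_one _)
      have b₃ := norm_add₃_le (a := x k (proj M u - proj N u)) (b := (x k).comp (proj N) u)
        (c := (x k - (x k).comp (proj M)) u)
      rw [← e] at b₃
      have := hd' n
      linarith
  choose kf Mf uf hkf hMf huf hlow hhigh hxu hsmall htail using hstep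
  let s : ℕ → ℕ × ℕ := fun n => Nat.rec (0, 0) (fun n p => (kf n p.1 p.2, Mf n p.1 p.2)) n
  let k : ℕ → ℕ := fun n => kf n (s n).1 (s n).2
  let u : ℕ → C₀(ℕ, ℂ) := fun n => uf n (s n).1 (s n).2
  have hkmono : StrictMono k := strictMono_nat_of_lt_succ fun n => hkf (n + 1) (s (n + 1)).1 _
  have hmono : Monotone fun n => (s n).2 := monotone_nat_of_le_succ fun n => hMf n (s n).1 _
  have hublock : ∀ (F : Finset ℕ), ‖∑ n ∈ F, u n‖ ≤ 1 := fun F => by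
    simpa using norm_sum_blocks_le hmono (v := u) (fun n => huf n _ _) (fun n => hlow n _ _)
      (fun n i hi => hhigh n _ _ i hi) F (a := 1) (by simp)
  have hdsum : ∀ F : Finset ℕ, ∑ n ∈ F, d n ≤ ε / 4 := fun F => by
    rw [← Finset.mul_sum]
    have := Summable.sum_le_tsum F (fun n _ => by positivity) summable_geometric_two
    rw [tsum_geometric_two] at this
    nlinarith
  have hoff : ∀ (F : Finset ℕ) (n), ‖x (k n) (∑ j ∈ F.erase n, u j)‖ ≤ 2 * d n := by
    intro F n
    set w := ∑ j ∈ F.erase n, u j with hw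
    have e : w = proj (s n).2 w + (w - proj (s (n + 1)).2 w) := by
      ext i
      rw [ZeroAtInftyContinuousMap.add_apply, ZeroAtInftyContinuousMap.sub_apply,
        proj_apply, proj_apply]
      have := hmono n.le_succ
      by_cases h₁ : i < (s n).2
      · rw [if_pos h₁, if_pos (h₁.trans_le this)]; ring
      · by_cases h₂ : i < (s (n + 1)).2
        · rw [if_neg h₁, if_pos h₂, hw, sum_apply, Finset.sum_eq_zero]
          · ring
          · intro j hj
            rcases lt_or_gt_of_ne (Finset.ne_of_mem_erase hj) with hj | hj
            · exact hhigh j _ _ i ((hmono (Nat.succ_le_of_lt hj)).trans (not_lt.1 h₁))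
            · exact hlow j _ _ i (h₂.trans_le (hmono (Nat.succ_le_of_lt hj)))
        · rw [if_neg h₁, if_neg h₂]; ring
    have e' : x (k n) w = (x (k n)).comp (proj (s n).2) w +
        (x (k n) - (x (k n)).comp (proj (s (n + 1)).2)) w := by
      conv_lhs => rw [e]
      simp
    have b₁ : ‖(x (k n)).comp (proj (s n).2) w‖ ≤ d n :=
      (ContinuousLinearMap.le_of_opNorm_le_of_le _ (hsmall n _ _) (hublock _)).trans_eq (mul_one _)
    have b₂ : ‖(x (k n) - (x (k n)).comp (proj (s (n + 1)).2)) w‖ ≤ d n :=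
      (ContinuousLinearMap.le_of_opNorm_le_of_le _ (htail n _ _) (hublock _)).trans_eq (mul_one _)
    rw [e']
    exact (norm_add_le _ _).trans (by linarith)
  have hwuc : IsWUC (C + ε / 2) fun n => x (k n) (u n) := by
    intro F a ha
    have e : ∑ n ∈ F, a n • x (k n) (u n) = (∑ n ∈ F, a n • x (k n)) (∑ j ∈ F, u j) -
        ∑ n ∈ F, a n • x (k n) (∑ j ∈ F.erase n, u j) := by
      rw [_root_.sum_apply, ← Finset.sum_sub_distrib]
      refine Finset.sum_congr rfl fun n hn => ?_
      rw [_root_.smul_apply, ← smul_sub, ← map_sub, ← Finset.add_sum_erase F u hn,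
        add_sub_cancel_right]
    have b₁ : ‖(∑ n ∈ F, a n • x (k n)) (∑ j ∈ F, u j)‖ ≤ C :=
      (ContinuousLinearMap.le_of_opNorm_le_of_le _ (hx.comp hkmono.injective F a ha)
        (hublock F)).trans_eq (mul_one _)
    have b₂ : ‖∑ n ∈ F, a n • x (k n) (∑ j ∈ F.erase n, u j)‖ ≤ ∑ n ∈ F, 2 * d n := by
      refine norm_sum_le_of_le _ fun n _ => ?_
      rw [norm_smul]
      exact (mul_le_of_le_one_left (norm_nonneg _) (ha n)).trans (hoff F n)
    rw [← Finset.mul_sum] at b₂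
    rw [e]
    refine (norm_sub_le _ _).trans ?_
    linarith [hdsum F]
  have hlim := hE _ _ hwuc
  obtain ⟨n, hn⟩ := ((tendsto_zero_iff_norm_tendsto_zero.1 hlim).eventually_lt_const
    (half_pos hε)).exists
  exact lt_asymm hn (hxu n _ _)

theorem hasNoC0_multilinear (m : ℕ) : HasNoC0 (C₀(ℕ, ℂ) [×m]→L[ℂ] ℂ) := by
  induction m with
  | zero =>
    exact hasNoC0_complex.of_linearIsometry
      (continuousMultilinearCurryFin0 ℂ C₀(ℕ, ℂ) ℂ).toLinearIsometry
  | succ m ih =>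
    exact ih.clm.of_linearIsometry
      (continuousMultilinearCurryLeftEquiv ℂ (fun _ : Fin (m + 1) => C₀(ℕ, ℂ)) ℂ).toLinearIsometry

theorem tendsto_comp_of_pointwise (hE : HasNoC0 E) {Q : ℕ → E →L[ℂ] E} (hQ : ∀ N, ‖Q N‖ ≤ 1)
    (hlim : ∀ y, Tendsto (fun N => Q N y) atTop (𝓝 y)) (T : C₀(ℕ, ℂ) →L[ℂ] E) :
    Tendsto (fun N => ((Q N).comp T).comp (proj N)) atTop (𝓝 T) := by
  rw [Metric.tendsto_atTop]
  intro ε hε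
  obtain ⟨K, hK⟩ := Metric.tendsto_atTop.1 (hE.tendsto_comp_proj T) (ε / 4) (by positivity)
  have h₂ := tendsto_comp_proj_of_pointwise (x := fun N => (Q N).comp T) (T := T) (l := atTop)
    (fun u => hlim (T u)) K
  obtain ⟨K', hK'⟩ := Metric.tendsto_atTop.1 h₂ (ε / 4) (by positivity)
  refine ⟨max K K', fun N hN => ?_⟩
  have a₁ := hK N (le_of_max_le_left hN)
  have a₂ := hK K le_rfl
  have a₃ := hK' N (le_of_max_le_right hN)
  have a₄ : dist (((Q N).comp T).comp (proj N)) (((Q N).comp T).comp (proj K)) ≤ ε / 2 := by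
    have : dist (T.comp (proj N)) (T.comp (proj K)) ≤ ε / 2 :=
      (dist_triangle_right _ _ T).trans (by linarith)
    rw [dist_eq_norm] at this ⊢
    rw [ContinuousLinearMap.comp_assoc, ContinuousLinearMap.comp_assoc,
      ← ContinuousLinearMap.comp_sub]
    refine (ContinuousLinearMap.opNorm_comp_le _ _).trans ?_
    exact (mul_le_of_le_one_left (norm_nonneg _) (hQ N)).trans this
  have t₁ := dist_triangle4 (((Q N).comp T).comp (proj N)) (((Q N).comp T).comp (proj K))
    (T.comp (proj K)) T
  linarith

end NoC0

section MultilinearForms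

set_option maxSynthPendingDepth 3

/-- A multilinear form on `c₀` is the norm limit of its restrictions to the first coordinates. -/
theorem tendsto_compContinuousLinearMap_proj (m : ℕ) (A : C₀(ℕ, ℂ) [×m]→L[ℂ] ℂ) :
    Tendsto (fun N => A.compContinuousLinearMap fun _ => proj N) atTop (𝓝 A) := by
  induction m with
  | zero =>
    refine tendsto_const_nhds.congr fun N => ?_
    ext v
    simp only [ContinuousMultilinearMap.compContinuousLinearMap_apply]
    congr 1
    exact Subsingleton.elim _ _
  | succ m ih =>
    let e := continuousMultilinearCurryLeftEquiv ℂ (fun _ : Fin (m + 1) => C₀(ℕ, ℂ)) ℂ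
    let Q : ℕ → (C₀(ℕ, ℂ) [×m]→L[ℂ] ℂ) →L[ℂ] (C₀(ℕ, ℂ) [×m]→L[ℂ] ℂ) := fun N =>
      ContinuousMultilinearMap.compContinuousLinearMapL fun _ => proj N
    have hQ : ∀ N, ‖Q N‖ ≤ 1 := fun N =>
      (ContinuousMultilinearMap.norm_compContinuousLinearMapL_le _ _).trans
        (Finset.prod_le_one (fun _ _ => norm_nonneg _) fun _ _ => norm_proj_le N)
    have := tendsto_comp_of_pointwise (hasNoC0_multilinear m) hQ ih A.curryLeft
    have h := (e.symm.continuous.tendsto _).comp this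
    have h0 : e.symm A.curryLeft = A := e.symm_apply_apply A
    rw [h0] at h
    refine h.congr fun N => ?_
    ext v
    simp only [Function.comp, e, Q]
    rw [continuousMultilinearCurryLeftEquiv_symm_apply]
    simp only [ContinuousLinearMap.comp_apply,
      ContinuousMultilinearMap.compContinuousLinearMapL_apply,
      ContinuousMultilinearMap.compContinuousLinearMap_apply,
      ContinuousMultilinearMap.curryLeft_apply]
    congr 1
    ext i : 1
    refine Fin.cases ?_ (fun j => ?_) i
    · simp
    · simp [Fin.tail]

end MultilinearForms

section AronBerner

set_option maxSynthPendingDepth 3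

/-- The first `N` coordinates of an element of the bidual of `c₀`. -/
def trunc (N : ℕ) (ζ : Bidual C₀(ℕ, ℂ)) : C₀(ℕ, ℂ) :=
  ∑ i ∈ Finset.range N, ζ (coordFun i) • unitVec i

theorem norm_bidual_coordFun_le (ζ : Bidual C₀(ℕ, ℂ)) (i : ℕ) : ‖ζ (coordFun i)‖ ≤ ‖ζ‖ :=
  (ζ.le_opNorm_of_le (norm_coordFun_le i)).trans_eq (mul_one _)

theorem norm_trunc_le (N : ℕ) (ζ : Bidual C₀(ℕ, ℂ)) : ‖trunc N ζ‖ ≤ ‖ζ‖ :=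
  norm_sum_smul_unitVec_le N (norm_nonneg _) fun i _ => norm_bidual_coordFun_le ζ i

theorem trunc_sub (N : ℕ) (ζ ξ : Bidual C₀(ℕ, ℂ)) : trunc N (ζ - ξ) = trunc N ζ - trunc N ξ := by
  simp [trunc, sub_smul]

theorem trunc_smul (N : ℕ) (c : ℂ) (ζ : Bidual C₀(ℕ, ℂ)) : trunc N (c • ζ) = c • trunc N ζ := by
  simp [trunc, Finset.smul_sum, smul_smul]

theorem bidual_apply_comp_proj (N : ℕ) (ζ : Bidual C₀(ℕ, ℂ)) (y : StrongDual ℂ C₀(ℕ, ℂ)) :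
    ζ (y.comp (proj N)) = y (trunc N ζ) := by
  have : y.comp (proj N) = ∑ i ∈ Finset.range N, y (unitVec i) • coordFun i := by
    ext x
    simp [proj_eq_sum, map_sum, mul_comm]
  rw [this]
  simp [trunc, map_sum, mul_comm]

theorem aronBerner_compContinuousLinearMap_proj (m N : ℕ) (ζ : Fin m → Bidual C₀(ℕ, ℂ))
    (A : C₀(ℕ, ℂ) [×m]→L[ℂ] ℂ) :
    aronBerner m ζ (A.compContinuousLinearMap fun _ => proj N) = A fun i => trunc N (ζ i) := by
  induction m with
  | zero =>
    change A _ = A _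
    congr 1
    exact Subsingleton.elim _ _
  | succ m ih =>
    rw [aronBerner_succ_apply]
    have : (aronBerner m (Fin.tail ζ)).comp
        (A.compContinuousLinearMap fun _ => proj N).curryLeft =
        ((ContinuousMultilinearMap.apply ℂ (fun _ : Fin m => C₀(ℕ, ℂ)) ℂ
          fun i => trunc N (Fin.tail ζ i)).comp A.curryLeft).comp (proj N) := by
      ext x
      have e : (A.compContinuousLinearMap fun _ => proj N).curryLeft x =
          (A.curryLeft (proj N x)).compContinuousLinearMap fun _ => proj N := by
        ext v
        simp only [ContinuousMultilinearMap.curryLeft_apply,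
          ContinuousMultilinearMap.compContinuousLinearMap_apply]
        congr 1
        ext i : 1
        refine Fin.cases ?_ (fun j => ?_) i <;> simp
      rw [ContinuousLinearMap.comp_apply, e, ih]
      rfl
    rw [this, bidual_apply_comp_proj]
    change A (Fin.cons _ _) = _
    congr 1
    ext i : 1
    refine Fin.cases ?_ (fun j => ?_) i <;> simp [Fin.tail]

/-- On `c₀` the Aron–Berner extension of a multilinear form is the limit of its values at the
truncations of the arguments. -/
theorem tendsto_aronBerner (m : ℕ) (ζ : Fin m → Bidual C₀(ℕ, ℂ)) (A : C₀(ℕ, ℂ) [×m]→L[ℂ] ℂ) :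
    Tendsto (fun N => A fun i => trunc N (ζ i)) atTop (𝓝 (aronBerner m ζ A)) := by
  simp only [← aronBerner_compContinuousLinearMap_proj]
  exact ((aronBerner m ζ).continuous.tendsto A).comp (tendsto_compContinuousLinearMap_proj m A)

end AronBerner

section Taylor

variable {X : Type*} [NormedAddCommGroup X] [NormedSpace ℂ X] {F : X → ℂ}

variable (F) in
/-- The multilinear form of degree `m` in the Taylor series of `F` at the origin. -/
def taylorForm (m : ℕ) : X [×m]→L[ℂ] ℂ := (Nat.factorial m : ℂ)⁻¹ • iteratedFDeriv ℂ m F 0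

theorem iteratedDeriv_comp_smul_eq (hF : AnalyticAt ℂ F 0) (m : ℕ) (x : X) :
    iteratedDeriv m (fun t : ℂ => F (t • x)) 0 = iteratedFDeriv ℂ m F 0 fun _ => x := by
  obtain ⟨p, r, hp⟩ := hF
  let u : ℂ →L[ℂ] X := ContinuousLinearMap.toSpanSingleton ℂ x
  have hu : u 0 = 0 := map_zero u
  have hp' : HasFPowerSeriesOnBall F p (u 0) r := by rwa [hu]
  have h₁ := hp'.compContinuousLinearMap.factorial_smul 1 m
  have h₂ := hp.factorial_smul x m
  rw [iteratedDeriv_eq_iteratedFDeriv]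
  have e : (F ∘ u) = fun t : ℂ => F (t • x) := by
    ext t; simp [u]
  rw [e] at h₁
  rw [← h₂, ← h₁, FormalMultilinearSeries.compContinuousLinearMap_apply]
  congr 2
  ext i
  simp [u]

theorem differentiableOn_comp_smul (hF : AnalyticOnNhd ℂ F (ball 0 1)) {x : X} {S : Set ℂ}
    (hS : ∀ t ∈ S, t • x ∈ ball (0 : X) 1) : DifferentiableOn ℂ (fun t : ℂ => F (t • x)) S :=
  hF.differentiableOn.comp (differentiable_id.smul_const x).differentiableOn hS

theorem hasSum_taylorForm (hF : AnalyticOnNhd ℂ F (ball 0 1)) {x : X} (hx : ‖x‖ < 1) :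
    HasSum (fun m => taylorForm F m fun _ => x) (F x) := by
  obtain ⟨R, hR, hRx⟩ : ∃ R : ℝ, 1 < R ∧ R * ‖x‖ < 1 := by
    rcases (norm_nonneg x).eq_or_lt with h | h
    · exact ⟨2, by norm_num, by rw [← h]; norm_num⟩
    · obtain ⟨R, h₁, h₂⟩ := exists_between ((one_lt_inv₀ h).2 hx)
      refine ⟨R, h₁, ?_⟩
      rwa [lt_inv_comm₀ (by linarith) h, ← one_div, lt_div_iff₀ (by linarith), mul_comm] at h₂
  have hmaps : ∀ t ∈ ball (0 : ℂ) R, t • x ∈ ball (0 : X) 1 := by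
    intro t ht
    rw [mem_ball_zero_iff] at ht ⊢
    rw [norm_smul]
    exact (mul_le_mul_of_nonneg_right ht.le (norm_nonneg _)).trans_lt hRx
  have := Complex.hasSum_taylorSeries_on_ball (differentiableOn_comp_smul hF hmaps)
    (z := 1) (by simpa using hR)
  simp only [sub_zero, one_pow, smul_eq_mul, one_smul] at this
  refine this.congr_fun ?_
  intro m
  rw [iteratedDeriv_comp_smul_eq (hF 0 (by simp))]
  simp [taylorForm]

theorem norm_taylorForm_le (hF : AnalyticOnNhd ℂ F (ball 0 1)) {C : ℝ}
    (hC : ∀ x ∈ ball (0 : X) 1, ‖F x‖ ≤ C) (m : ℕ) (x : X) :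
    ‖taylorForm F m fun _ => x‖ ≤ C * ‖x‖ ^ m := by
  have key : ∀ y : X, ‖y‖ < 1 → ‖taylorForm F m fun _ => y‖ ≤ C := by
    intro y hy
    have hmaps : ∀ t ∈ closedBall (0 : ℂ) 1, t • y ∈ ball (0 : X) 1 := by
      intro t ht
      rw [mem_closedBall_zero_iff] at ht
      rw [mem_ball_zero_iff, norm_smul]
      exact (mul_le_of_le_one_left (norm_nonneg _) ht).trans_lt hy
    have hd : DiffContOnCl ℂ (fun t : ℂ => F (t • y)) (ball 0 1) := by
      refine DifferentiableOn.diffContOnCl ?_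
      rw [closure_ball _ one_ne_zero]
      exact differentiableOn_comp_smul hF hmaps
    have := Complex.norm_iteratedDeriv_le_of_forall_mem_sphere_norm_le m one_pos hd
      fun t ht => hC _ (hmaps t (sphere_subset_closedBall ht))
    rw [iteratedDeriv_comp_smul_eq (hF 0 (by simp)), one_pow, div_one] at this
    have hm : (0 : ℝ) < Nat.factorial m := by positivity
    rw [taylorForm, _root_.smul_apply, norm_smul, norm_inv, Complex.norm_natCast]
    rwa [inv_mul_le_iff₀ hm]
  have hlim : Tendsto (fun R : ℝ => C * R ^ m) (𝓝[>] ‖x‖) (𝓝 (C * ‖x‖ ^ m)) :=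
    ((continuous_const.mul (continuous_pow m)).tendsto _).mono_left nhdsWithin_le_nhds
  refine ge_of_tendsto hlim ?_
  filter_upwards [self_mem_nhdsWithin] with R hR
  have hR : ‖x‖ < R := hR
  have hR0 : 0 < R := (norm_nonneg x).trans_lt hR
  have hy : ‖((R : ℂ)⁻¹) • x‖ < 1 := by
    rw [norm_smul, norm_inv, Complex.norm_real, Real.norm_of_nonneg hR0.le, inv_mul_lt_iff₀ hR0]
    linarith
  have e := (taylorForm F m).map_smul_univ (fun _ => (R : ℂ)⁻¹) fun _ => x
  have h := key _ hy
  rw [e, norm_smul, Finset.prod_const, Finset.card_fin, norm_pow, norm_inv, Complex.norm_real,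
    Real.norm_of_nonneg hR0.le, inv_pow, inv_mul_le_iff₀ (pow_pos hR0 m), mul_comm] at h
  exact h

end Taylor

section AuBasic

variable {X : Type*} [NormedAddCommGroup X] [NormedSpace ℂ X]

theorem norm_ext_le (f : Au X) (x : X) : ‖ext (f : ball (0 : X) 1 →ᵇ ℂ) x‖ ≤ ‖f‖ := by
  by_cases hx : x ∈ ball (0 : X) 1
  · rw [ext_apply _ x hx]
    exact (f : ball (0 : X) 1 →ᵇ ℂ).norm_coe_le_norm _
  · rw [ext, Function.extend_apply' _ _ _ (by rintro ⟨y, rfl⟩; exact hx y.2), Pi.zero_apply,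
      norm_zero]
    exact norm_nonneg _

theorem uniformContinuousOn_ext (f : Au X) :
    UniformContinuousOn (ext (f : ball (0 : X) 1 →ᵇ ℂ)) (ball 0 1) := by
  rw [uniformContinuousOn_iff_restrict]
  convert f.2.2 using 1
  ext x
  exact ext_apply _ x.1 x.2

/-- The element of `𝒜ᵤ(B_X)` given by a function that is analytic, uniformly continuous and
bounded on the ball. -/
def mkAu (F : X → ℂ) (hF : AnalyticOnNhd ℂ F (ball 0 1)) (hu : UniformContinuousOn F (ball 0 1))
    (C : ℝ) (hC : ∀ x ∈ ball (0 : X) 1, ‖F x‖ ≤ C) : Au X :=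
  ⟨BoundedContinuousFunction.ofNormedAddCommGroup (fun x : ball (0 : X) 1 => F x)
      (uniformContinuousOn_iff_restrict.1 hu).continuous C fun x => hC x x.2,
    hF.congr isOpen_ball fun x hx => by rw [ext_apply _ x hx]; rfl,
    uniformContinuousOn_iff_restrict.1 hu⟩

theorem ext_mkAu {F : X → ℂ} (hF : AnalyticOnNhd ℂ F (ball 0 1))
    (hu : UniformContinuousOn F (ball 0 1)) (C : ℝ) (hC : ∀ x ∈ ball (0 : X) 1, ‖F x‖ ≤ C)
    {x : X} (hx : x ∈ ball (0 : X) 1) :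
    ext (mkAu F hF hu C hC : ball (0 : X) 1 →ᵇ ℂ) x = F x := by
  rw [ext_apply _ x hx]; rfl

theorem norm_le_of_forall_ext_le (f : Au X) {C : ℝ} (hC : 0 ≤ C)
    (h : ∀ x ∈ ball (0 : X) 1, ‖ext (f : ball (0 : X) 1 →ᵇ ℂ) x‖ ≤ C) : ‖f‖ ≤ C := by
  change ‖(f : ball (0 : X) 1 →ᵇ ℂ)‖ ≤ C
  rw [BoundedContinuousFunction.norm_le hC]
  intro x
  exact (congrArg norm (ext_apply _ x.1 x.2)).symm.trans_le (h x.1 x.2)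

/-- A contractive unital character, unbundled. -/
structure IsChar (L : Au X → ℂ) : Prop where
  map_one : L 1 = 1
  map_add : ∀ f g, L (f + g) = L f + L g
  map_smul : ∀ (c : ℂ) f, L (c • f) = c * L f
  map_mul : ∀ f g, L (f * g) = L f * L g
  norm_le : ∀ f, ‖L f‖ ≤ ‖f‖

theorem isChar_ext {x : X} (hx : x ∈ ball (0 : X) 1) :
    IsChar fun f : Au X => ext (f : ball (0 : X) 1 →ᵇ ℂ) x where
  map_one := by rw [ext_apply _ x hx]; rfl
  map_add f g := by simp only [ext_apply _ x hx]; rfl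
  map_smul c f := by simp only [ext_apply _ x hx]; rfl
  map_mul f g := by simp only [ext_apply _ x hx]; rfl
  norm_le f := norm_ext_le f x

theorem IsChar.of_tendsto {ι : Type*} {l : Filter ι} [l.NeBot] {Λ : ι → Au X → ℂ} {L : Au X → ℂ}
    (hΛ : ∀ᶠ i in l, IsChar (Λ i)) (h : ∀ f, Tendsto (fun i => Λ i f) l (𝓝 (L f))) : IsChar L where
  map_one := tendsto_nhds_unique (h 1)
    (tendsto_const_nhds.congr' (hΛ.mono fun _ hi => hi.map_one.symm))
  map_add f g := tendsto_nhds_unique (h _)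
    (((h f).add (h g)).congr' (hΛ.mono fun _ hi => (hi.map_add f g).symm))
  map_smul c f := tendsto_nhds_unique (h _)
    (((h f).const_mul c).congr' (hΛ.mono fun _ hi => (hi.map_smul c f).symm))
  map_mul f g := tendsto_nhds_unique (h _)
    (((h f).mul (h g)).congr' (hΛ.mono fun _ hi => (hi.map_mul f g).symm))
  norm_le f := le_of_tendsto (h f).norm (hΛ.mono fun _ hi => hi.norm_le f)

/-- The point of the spectrum given by a contractive character. -/
def IsChar.toSpec {L : Au X → ℂ} (hL : IsChar L) : Spec X :=
  ⟨StrongDual.toWeakDual (LinearMap.mkContinuous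
      { toFun := L
        map_add' := hL.map_add
        map_smul' := hL.map_smul } 1 fun f =>
        (hL.norm_le f).trans_eq (one_mul _).symm),
    fun h => by
      have h1 : L 1 = 0 := congrArg (fun φ : WeakDual ℂ (Au X) => φ 1) h
      rw [hL.map_one] at h1
      exact one_ne_zero h1,
    hL.map_mul⟩

theorem IsChar.toSpec_apply {L : Au X → ℂ} (hL : IsChar L) (f : Au X) : hL.toSpec f = L f := rfl

theorem norm_pow_Au_le (f : Au X) (n : ℕ) : ‖f ^ n‖ ≤ ‖f‖ ^ n := by
  refine norm_le_of_forall_ext_le _ (pow_nonneg (norm_nonneg f) n) fun x hx => ?_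
  have e : ext ((f ^ n : Au X) : ball (0 : X) 1 →ᵇ ℂ) x =
      ext (f : ball (0 : X) 1 →ᵇ ℂ) x ^ n := by
    rw [ext_apply _ x hx, ext_apply _ x hx]
    rfl
  rw [e, norm_pow]
  exact pow_le_pow_left₀ (norm_nonneg _) (norm_ext_le f x) n

theorem norm_spec_apply_le (φ : Spec X) (f : Au X) : ‖φ f‖ ≤ ‖f‖ := by
  let T := WeakDual.toStrongDual (φ : WeakDual ℂ (Au X))
  obtain ⟨C, hC⟩ : ∃ C : ℝ, ∀ n : ℕ, ‖φ f‖ ^ n ≤ C * ‖f‖ ^ n := by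
    refine ⟨‖T‖, fun n => ?_⟩
    have h₂ : T (f ^ n) = φ f ^ n := map_pow φ f n
    rw [← norm_pow, ← h₂]
    exact T.le_opNorm_of_le (norm_pow_Au_le f n)
  generalize ‖φ f‖ = a at *
  have hb := norm_nonneg f
  generalize ‖f‖ = b at *
  by_contra! hlt
  rcases hb.eq_or_lt with rfl | h0
  · have := hC 1
    simp only [pow_one, mul_zero] at this
    linarith
  · obtain ⟨n, hn⟩ := pow_unbounded_of_one_lt C ((one_lt_div h0).2 hlt)
    rw [div_pow, lt_div_iff₀ (pow_pos h0 n)] at hn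
    exact absurd (hC n) (not_le.2 hn)

theorem nhdsWithin_ball_neBot {E : Type*} [NormedAddCommGroup E] [NormedSpace ℂ E] {a : E}
    (ha : a ∈ closedBall (0 : E) 1) : (𝓝[ball (0 : E) 1] a).NeBot := by
  rw [← mem_closure_iff_nhdsWithin_neBot, closure_ball _ one_ne_zero]
  exact ha

theorem tendsto_extendFrom_ball {E : Type*} [NormedAddCommGroup E] [NormedSpace ℂ E] {g : E → ℂ}
    (hg : UniformContinuousOn g (ball 0 1)) {a : E} (ha : a ∈ closedBall (0 : E) 1) :
    Tendsto g (𝓝[ball 0 1] a) (𝓝 (extendFrom (ball 0 1) g a)) := by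
  have := nhdsWithin_ball_neBot ha
  refine tendsto_extendFrom (cauchy_map_iff_exists_tendsto.1 ?_)
  exact (cauchy_nhds.mono nhdsWithin_le_nhds).map_of_le hg inf_le_right

theorem tendsto_evalClosed (f : Au X) {a : X} (ha : a ∈ closedBall (0 : X) 1) :
    Tendsto (ext (f : ball (0 : X) 1 →ᵇ ℂ)) (𝓝[ball 0 1] a) (𝓝 (evalClosed f a)) :=
  tendsto_extendFrom_ball (uniformContinuousOn_ext f) ha

theorem isChar_evalClosed {a : X} (ha : a ∈ closedBall (0 : X) 1) :
    IsChar fun f : Au X => evalClosed f a :=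
  have := nhdsWithin_ball_neBot ha
  IsChar.of_tendsto (l := 𝓝[ball 0 1] a) (eventually_mem_nhdsWithin.mono fun _ => isChar_ext)
    fun f => tendsto_evalClosed f ha

end AuBasic

section CanonicalExt

set_option maxSynthPendingDepth 3

theorem tendsto_canonicalExt (f : Au C₀(ℕ, ℂ)) {ζ : Bidual C₀(ℕ, ℂ)} (hζ : ‖ζ‖ < 1) :
    Tendsto (fun N => ext (f : ball (0 : C₀(ℕ, ℂ)) 1 →ᵇ ℂ) (trunc N ζ)) atTop
      (𝓝 (canonicalExt f ζ)) := by
  have hlim : Tendsto (fun N => ∑' m, taylorForm (ext (f : ball (0 : C₀(ℕ, ℂ)) 1 →ᵇ ℂ)) m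
      fun _ => trunc N ζ) atTop (𝓝 (canonicalExt f ζ)) := by
    refine tendsto_tsum_of_dominated_convergence (bound := fun m => ‖f‖ * ‖ζ‖ ^ m)
      ((summable_geometric_of_lt_one (norm_nonneg _) hζ).mul_left _) (fun m => ?_) ?_
    · exact tendsto_aronBerner m (fun _ => ζ) _
    · refine Eventually.of_forall fun N m => ?_
      refine (norm_taylorForm_le f.2.1 (fun x _ => norm_ext_le f x) m _).trans ?_
      gcongr
      exact norm_trunc_le N ζ
  refine hlim.congr fun N => ?_
  exact (hasSum_taylorForm f.2.1 ((norm_trunc_le N ζ).trans_lt hζ)).tsum_eq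

theorem isChar_canonicalExt {ζ : Bidual C₀(ℕ, ℂ)} (hζ : ‖ζ‖ < 1) :
    IsChar fun f : Au C₀(ℕ, ℂ) => canonicalExt f ζ :=
  IsChar.of_tendsto (l := atTop) (Eventually.of_forall fun N =>
    isChar_ext (mem_ball_zero_iff.2 ((norm_trunc_le N ζ).trans_lt hζ)))
    fun f => tendsto_canonicalExt f hζ

theorem uniformContinuousOn_canonicalExt (f : Au C₀(ℕ, ℂ)) :
    UniformContinuousOn (canonicalExt f) (ball 0 1) := by
  rw [Metric.uniformContinuousOn_iff_le]
  intro ε hε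
  obtain ⟨d, hd, h⟩ := Metric.uniformContinuousOn_iff_le.1 (uniformContinuousOn_ext f) ε hε
  refine ⟨d, hd, fun ζ hζ ξ hξ hζξ => ?_⟩
  rw [mem_ball_zero_iff] at hζ hξ
  refine le_of_tendsto ((tendsto_canonicalExt f hζ).dist (tendsto_canonicalExt f hξ))
    (Eventually.of_forall fun N => h _ ?_ _ ?_ ?_)
  · exact mem_ball_zero_iff.2 ((norm_trunc_le N ζ).trans_lt hζ)
  · exact mem_ball_zero_iff.2 ((norm_trunc_le N ξ).trans_lt hξ)
  · rw [dist_eq_norm, ← trunc_sub]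
    refine (norm_trunc_le N _).trans ?_
    rwa [← dist_eq_norm]

theorem tendsto_canonicalExtClosed (f : Au C₀(ℕ, ℂ)) {ζ : Bidual C₀(ℕ, ℂ)}
    (hζ : ζ ∈ closedBall (0 : Bidual C₀(ℕ, ℂ)) 1) :
    Tendsto (canonicalExt f) (𝓝[ball 0 1] ζ) (𝓝 (canonicalExtClosed f ζ)) :=
  tendsto_extendFrom_ball (uniformContinuousOn_canonicalExt f) hζ

theorem isChar_canonicalExtClosed {ζ : Bidual C₀(ℕ, ℂ)}
    (hζ : ζ ∈ closedBall (0 : Bidual C₀(ℕ, ℂ)) 1) :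
    IsChar fun f : Au C₀(ℕ, ℂ) => canonicalExtClosed f ζ :=
  have := nhdsWithin_ball_neBot hζ
  IsChar.of_tendsto (l := 𝓝[ball 0 1] ζ) (eventually_mem_nhdsWithin.mono fun _ h =>
    isChar_canonicalExt (mem_ball_zero_iff.1 h)) fun f => tendsto_canonicalExtClosed f hζ

/-- Radial approach to a point of the closed ball. -/
theorem tendsto_smul_nhdsWithin_ball {E : Type*} [NormedAddCommGroup E] [NormedSpace ℂ E] {a : E}
    (ha : a ∈ closedBall (0 : E) 1) :
    Tendsto (fun r : ℝ => (r : ℂ) • a) (𝓝[Set.Ioo 0 1] 1) (𝓝[ball 0 1] a) := by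
  refine tendsto_nhdsWithin_iff.2 ⟨?_, ?_⟩
  · have : Continuous fun r : ℝ => (r : ℂ) • a := Complex.continuous_ofReal.smul continuous_const
    simpa using (this.tendsto 1).mono_left nhdsWithin_le_nhds
  · filter_upwards [self_mem_nhdsWithin] with r hr
    rw [mem_ball_zero_iff, norm_smul, Complex.norm_real, Real.norm_of_nonneg hr.1.le]
    exact (mul_le_of_le_one_right hr.1.le (mem_closedBall_zero_iff.1 ha)).trans_lt hr.2

instance nhdsWithin_Ioo_one_neBot : (𝓝[Set.Ioo (0 : ℝ) 1] 1).NeBot := by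
  rw [← mem_closure_iff_nhdsWithin_neBot, closure_Ioo zero_ne_one]
  simp

/-- A closed relation between the values of `f` at the contracted truncations of two points of the
bidual passes to the values of the canonical extension. -/
theorem canonicalExtClosed_mem_of_isClosed (f : Au C₀(ℕ, ℂ)) {ζ ξ : Bidual C₀(ℕ, ℂ)}
    (hζ : ζ ∈ closedBall (0 : Bidual C₀(ℕ, ℂ)) 1) (hξ : ξ ∈ closedBall (0 : Bidual C₀(ℕ, ℂ)) 1)
    {K : Set (ℂ × ℂ)} (hK : IsClosed K)
    (h : ∀ r ∈ Set.Ioo (0 : ℝ) 1, ∀ N,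
      (ext (f : ball (0 : C₀(ℕ, ℂ)) 1 →ᵇ ℂ) ((r : ℂ) • trunc N ζ),
        ext (f : ball (0 : C₀(ℕ, ℂ)) 1 →ᵇ ℂ) ((r : ℂ) • trunc N ξ)) ∈ K) :
    (canonicalExtClosed f ζ, canonicalExtClosed f ξ) ∈ K := by
  have t₁ := (tendsto_canonicalExtClosed f hζ).comp (tendsto_smul_nhdsWithin_ball hζ)
  have t₂ := (tendsto_canonicalExtClosed f hξ).comp (tendsto_smul_nhdsWithin_ball hξ)
  refine hK.mem_of_tendsto (t₁.prodMk_nhds t₂) ?_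
  filter_upwards [self_mem_nhdsWithin] with r hr
  have hlt : ∀ η ∈ closedBall (0 : Bidual C₀(ℕ, ℂ)) 1, ‖(r : ℂ) • η‖ < 1 := fun η hη => by
    rw [norm_smul, Complex.norm_real, Real.norm_of_nonneg hr.1.le]
    exact (mul_le_of_le_one_right hr.1.le (mem_closedBall_zero_iff.1 hη)).trans_lt hr.2
  refine hK.mem_of_tendsto
    ((tendsto_canonicalExt f (hlt ζ hζ)).prodMk_nhds (tendsto_canonicalExt f (hlt ξ hξ)))
    (Eventually.of_forall fun N => ?_)
  rw [trunc_smul, trunc_smul]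
  exact h r hr N

end CanonicalExt

section Composition

variable {X Y : Type*} [NormedAddCommGroup X] [NormedSpace ℂ X] [NormedAddCommGroup Y]
  [NormedSpace ℂ Y]

/-- Composition of an element of `𝒜ᵤ(B_Y)` with an analytic, uniformly continuous map of the ball
of `X` into the ball of `Y`. -/
def compAu (g : Au Y) (Φ : X → Y) (hΦ : AnalyticOnNhd ℂ Φ (ball 0 1))
    (hm : Set.MapsTo Φ (ball 0 1) (ball 0 1)) (hu : UniformContinuousOn Φ (ball 0 1)) : Au X :=
  mkAu (ext (g : ball (0 : Y) 1 →ᵇ ℂ) ∘ Φ) (g.2.1.comp hΦ hm)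
    ((uniformContinuousOn_ext g).comp hu hm) ‖g‖ fun x _ => norm_ext_le g (Φ x)

variable {g : Au Y} {Φ : X → Y} {hΦ : AnalyticOnNhd ℂ Φ (ball 0 1)}
    {hm : Set.MapsTo Φ (ball 0 1) (ball 0 1)} {hu : UniformContinuousOn Φ (ball 0 1)}

theorem ext_compAu {x : X} (hx : x ∈ ball (0 : X) 1) :
    ext (compAu g Φ hΦ hm hu : ball (0 : X) 1 →ᵇ ℂ) x =
      ext (g : ball (0 : Y) 1 →ᵇ ℂ) (Φ x) :=
  ext_mkAu _ _ _ _ hx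

theorem norm_compAu_le : ‖compAu g Φ hΦ hm hu‖ ≤ ‖g‖ :=
  norm_le_of_forall_ext_le _ (norm_nonneg g) fun x hx => by
    rw [ext_compAu hx]
    exact norm_ext_le g _

theorem evalClosed_eq_of_tendsto {f : Au X} {a : X} (ha : a ∈ closedBall (0 : X) 1) {b : ℂ}
    (h : Tendsto (ext (f : ball (0 : X) 1 →ᵇ ℂ)) (𝓝[ball 0 1] a) (𝓝 b)) : evalClosed f a = b :=
  have := nhdsWithin_ball_neBot ha
  tendsto_nhds_unique (tendsto_evalClosed f ha) h

theorem evalClosed_mkAu {F : X → ℂ} (hF : AnalyticOnNhd ℂ F (ball 0 1))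
    (hu : UniformContinuousOn F (ball 0 1)) (C : ℝ) (hC : ∀ x ∈ ball (0 : X) 1, ‖F x‖ ≤ C)
    {a : X} (ha : a ∈ closedBall (0 : X) 1) (hFa : ContinuousAt F a) :
    evalClosed (mkAu F hF hu C hC) a = F a :=
  evalClosed_eq_of_tendsto ha ((hFa.tendsto.mono_left nhdsWithin_le_nhds).congr'
    (eventually_mem_nhdsWithin.mono fun _ hx => (ext_mkAu hF hu C hC hx).symm))

theorem evalClosed_of_mem_ball (f : Au X) {a : X} (ha : a ∈ ball (0 : X) 1) :
    evalClosed f a = ext (f : ball (0 : X) 1 →ᵇ ℂ) a :=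
  evalClosed_eq_of_tendsto (ball_subset_closedBall ha)
    ((f.2.1 a ha).continuousAt.tendsto.mono_left nhdsWithin_le_nhds)

theorem evalClosed_compAu {a : X} (ha : a ∈ closedBall (0 : X) 1)
    (hΦa : ContinuousAt Φ a) (hb : Φ a ∈ closedBall (0 : Y) 1) :
    evalClosed (compAu g Φ hΦ hm hu) a = evalClosed g (Φ a) :=
  evalClosed_eq_of_tendsto ha (((tendsto_evalClosed g hb).comp (tendsto_nhdsWithin_iff.2
    ⟨hΦa.tendsto.mono_left nhdsWithin_le_nhds,
      eventually_mem_nhdsWithin.mono fun _ hx => hm hx⟩)).congr'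
    (eventually_mem_nhdsWithin.mono fun _ hx => (ext_compAu hx).symm))

/-- The identity function of the disc. -/
def idAu : Au ℂ :=
  mkAu id analyticOnNhd_id uniformContinuous_id.uniformContinuousOn 1
    fun _ hx => (mem_ball_zero_iff.1 hx).le

theorem norm_idAu_le : ‖idAu‖ ≤ 1 :=
  norm_le_of_forall_ext_le _ zero_le_one fun x hx => by
    rw [idAu, ext_mkAu _ _ _ _ hx]
    exact (mem_ball_zero_iff.1 hx).le

theorem evalClosed_idAu {a : ℂ} (ha : a ∈ closedBall (0 : ℂ) 1) : evalClosed idAu a = a :=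
  evalClosed_mkAu _ _ _ _ ha continuousAt_id

end Composition

section Coordinates

set_option maxSynthPendingDepth 3

theorem mapsTo_coordFun (n : ℕ) :
    Set.MapsTo (coordFun n) (ball (0 : C₀(ℕ, ℂ)) 1) (ball 0 1) := fun x hx =>
  mem_ball_zero_iff.2 ((norm_apply_le x n).trans_lt (mem_ball_zero_iff.1 hx))

/-- The composition of an element of the disc algebra with the `n`-th coordinate of `c₀`. -/
def coordComp (n : ℕ) (g : Au ℂ) : Au C₀(ℕ, ℂ) :=
  compAu g (coordFun n) ((coordFun n).analyticOnNhd _)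
    (mapsTo_coordFun n) (coordFun n).uniformContinuous.uniformContinuousOn

theorem ext_coordComp (n : ℕ) (g : Au ℂ) {x : C₀(ℕ, ℂ)} (hx : x ∈ ball (0 : C₀(ℕ, ℂ)) 1) :
    ext (coordComp n g : ball (0 : C₀(ℕ, ℂ)) 1 →ᵇ ℂ) x = ext (g : ball (0 : ℂ) 1 →ᵇ ℂ) (x n) :=
  ext_compAu hx

theorem norm_coordComp_le (n : ℕ) (g : Au ℂ) : ‖coordComp n g‖ ≤ ‖g‖ := norm_compAu_le

theorem trunc_apply (N : ℕ) (ζ : Bidual C₀(ℕ, ℂ)) (n : ℕ) :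
    trunc N ζ n = if n < N then ζ (coordFun n) else 0 :=
  sum_smul_unitVec_apply N _ n

theorem bidual_coordFun_mem_closedBall {ζ : Bidual C₀(ℕ, ℂ)}
    (hζ : ζ ∈ closedBall (0 : Bidual C₀(ℕ, ℂ)) 1) (n : ℕ) :
    ζ (coordFun n) ∈ closedBall (0 : ℂ) 1 :=
  mem_closedBall_zero_iff.2 ((norm_bidual_coordFun_le ζ n).trans (mem_closedBall_zero_iff.1 hζ))

theorem canonicalExt_coordComp (n : ℕ) (g : Au ℂ) {ζ : Bidual C₀(ℕ, ℂ)} (hζ : ‖ζ‖ < 1) :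
    canonicalExt (coordComp n g) ζ = ext (g : ball (0 : ℂ) 1 →ᵇ ℂ) (ζ (coordFun n)) := by
  refine tendsto_nhds_unique (tendsto_canonicalExt _ hζ) (tendsto_const_nhds.congr' ?_)
  filter_upwards [eventually_gt_atTop n] with N hN
  rw [ext_coordComp n g (mem_ball_zero_iff.2 ((norm_trunc_le N ζ).trans_lt hζ)),
    trunc_apply, if_pos hN]

theorem canonicalExtClosed_coordComp (n : ℕ) (g : Au ℂ) {ζ : Bidual C₀(ℕ, ℂ)}
    (hζ : ζ ∈ closedBall (0 : Bidual C₀(ℕ, ℂ)) 1) :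
    canonicalExtClosed (coordComp n g) ζ = evalClosed g (ζ (coordFun n)) := by
  have t₁ := (tendsto_canonicalExtClosed (coordComp n g) hζ).comp (tendsto_smul_nhdsWithin_ball hζ)
  have t₂ := (tendsto_evalClosed g (bidual_coordFun_mem_closedBall hζ n)).comp
    (tendsto_smul_nhdsWithin_ball (bidual_coordFun_mem_closedBall hζ n))
  refine tendsto_nhds_unique t₁ (t₂.congr' ?_)
  filter_upwards [(tendsto_smul_nhdsWithin_ball hζ).eventually eventually_mem_nhdsWithin] with r hr
  rw [Function.comp_apply, Function.comp_apply, canonicalExt_coordComp n g (mem_ball_zero_iff.1 hr)]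
  rfl

theorem toBidual_coordFun (z : ℓ^∞(ℕ, ℂ)) (n : ℕ) : toBidual z (coordFun n) = z n := by
  change ∑' k, z k * unitVec k n = z n
  rw [tsum_eq_single n]
  · simp [unitVec_apply]
  · intro k hk
    simp [unitVec_apply, hk.symm]

theorem toBidual_mem_closedBall {z : ℓ^∞(ℕ, ℂ)} (hz : z ∈ closedBall (0 : ℓ^∞(ℕ, ℂ)) 1) :
    toBidual z ∈ closedBall (0 : Bidual C₀(ℕ, ℂ)) 1 :=
  mem_closedBall_zero_iff.2 ((LinearMap.mkContinuous_norm_le _ (norm_nonneg z) _).trans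
    (mem_closedBall_zero_iff.1 hz))

/-- The coordinate polynomial obtained by restricting a multilinear form to the diagonal and to
the first `N` coordinates. -/
def polyAu {m : ℕ} (A : C₀(ℕ, ℂ) [×m]→L[ℂ] ℂ) (N : ℕ) : Au C₀(ℕ, ℂ) :=
  ∑ s ∈ Fintype.piFinset fun _ : Fin m => Finset.range N,
    A (fun i => unitVec (s i)) • ∏ i, coordComp (s i) idAu

theorem ext_coordComp_idAu (n : ℕ) {x : C₀(ℕ, ℂ)} (hx : x ∈ ball (0 : C₀(ℕ, ℂ)) 1) :
    ext (coordComp n idAu : ball (0 : C₀(ℕ, ℂ)) 1 →ᵇ ℂ) x = x n := by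
  rw [ext_coordComp n _ hx, idAu, ext_mkAu, id]
  exact mapsTo_coordFun n hx

theorem spec_polyAu (φ : Spec C₀(ℕ, ℂ)) {m : ℕ} (A : C₀(ℕ, ℂ) [×m]→L[ℂ] ℂ) (N : ℕ) :
    φ (polyAu A N) = ∑ s ∈ Fintype.piFinset fun _ : Fin m => Finset.range N,
      A (fun i => unitVec (s i)) * ∏ i, φ (coordComp (s i) idAu) := by
  simp only [polyAu, map_sum, map_smul, map_prod, smul_eq_mul]

theorem ext_polyAu {m : ℕ} (A : C₀(ℕ, ℂ) [×m]→L[ℂ] ℂ) (N : ℕ) {x : C₀(ℕ, ℂ)}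
    (hx : x ∈ ball (0 : C₀(ℕ, ℂ)) 1) :
    ext (polyAu A N : ball (0 : C₀(ℕ, ℂ)) 1 →ᵇ ℂ) x = A fun _ => proj N x := by
  have h := spec_polyAu (isChar_ext hx).toSpec A N
  simp only [IsChar.toSpec_apply, ext_coordComp_idAu _ hx] at h
  rw [h]
  simp only [proj_eq_sum]
  rw [A.map_sum_finset]
  refine Finset.sum_congr rfl fun s _ => ?_
  rw [A.map_smul_univ, smul_eq_mul, mul_comm]

/-- The polynomials in the coordinates are dense in `𝒜ᵤ(B_{c₀})`. -/
theorem exists_poly_approx (f : Au C₀(ℕ, ℂ)) {ε : ℝ} (hε : 0 < ε) :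
    ∃ (M N : ℕ) (r : ℂ), ‖f - ∑ m ∈ Finset.range M,
      r ^ m • polyAu (taylorForm (ext (f : ball (0 : C₀(ℕ, ℂ)) 1 →ᵇ ℂ)) m) N‖ ≤ ε := by
  set F := ext (f : ball (0 : C₀(ℕ, ℂ)) 1 →ᵇ ℂ) with hF
  obtain ⟨d, hd, hunif⟩ := Metric.uniformContinuousOn_iff_le.1 (uniformContinuousOn_ext f)
    (ε / 3) (by positivity)
  obtain ⟨r, hr₀, hr₁, hrd⟩ : ∃ r : ℝ, 0 < r ∧ r < 1 ∧ 1 - r ≤ d :=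
    ⟨max (1 - d) (1 / 2), by positivity, max_lt (by linarith) (by norm_num),
      by linarith [le_max_left (1 - d) (1 / 2)]⟩
  have hnr : ‖(r : ℂ)‖ = r := by rw [Complex.norm_real, Real.norm_of_nonneg hr₀.le]
  have hsum : Summable fun m => ‖f‖ * r ^ m :=
    (summable_geometric_of_lt_one hr₀.le hr₁).mul_left _
  obtain ⟨M, hM⟩ := ((tendsto_sum_nat_add fun m => ‖f‖ * r ^ m).eventually_lt_const
    (show (0 : ℝ) < ε / 3 by positivity)).exists
  have hN : ∀ᶠ N in atTop, ∀ m ∈ Finset.range M, ‖taylorForm F m -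
      (taylorForm F m).compContinuousLinearMap fun _ => proj N‖ < ε / 3 / (M + 1) := by
    rw [eventually_all_finset]
    intro m _
    have := ((tendsto_compContinuousLinearMap_proj m (taylorForm F m)).const_sub
      (taylorForm F m)).norm
    rw [sub_self, norm_zero] at this
    exact this.eventually_lt_const (by positivity)
  obtain ⟨N, hN⟩ := hN.exists
  refine ⟨M, N, r, norm_le_of_forall_ext_le _ hε.le fun x hx => ?_⟩
  have hx1 := mem_ball_zero_iff.1 hx
  have hrx : ‖(r : ℂ) • x‖ ≤ r := by
    rw [norm_smul, hnr]
    exact mul_le_of_le_one_right hr₀.le hx1.le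
  have hrx' : (r : ℂ) • x ∈ ball (0 : C₀(ℕ, ℂ)) 1 := mem_ball_zero_iff.2 (hrx.trans_lt hr₁)
  have hext : ext ((f - ∑ m ∈ Finset.range M, (r : ℂ) ^ m • polyAu (taylorForm F m) N :
      Au C₀(ℕ, ℂ)) : ball (0 : C₀(ℕ, ℂ)) 1 →ᵇ ℂ) x =
      F x - ∑ m ∈ Finset.range M, (r : ℂ) ^ m * taylorForm F m fun _ => proj N x := by
    have := map_sub (isChar_ext hx).toSpec f
      (∑ m ∈ Finset.range M, (r : ℂ) ^ m • polyAu (taylorForm F m) N)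
    simp only [map_sum, map_smul, IsChar.toSpec_apply, ext_polyAu _ _ hx, smul_eq_mul] at this
    exact this
  rw [hext]
  have h₁ : ‖F x - F ((r : ℂ) • x)‖ ≤ ε / 3 := by
    rw [← dist_eq_norm]
    refine hunif x hx _ hrx' ?_
    have e : x - (r : ℂ) • x = ((1 - r : ℝ) : ℂ) • x := by
      push_cast
      rw [sub_smul, one_smul]
    rw [dist_eq_norm, e, norm_smul, Complex.norm_real, Real.norm_of_nonneg (by linarith)]
    exact (mul_le_of_le_one_right (by linarith) hx1.le).trans hrd
  have hT : ∀ m, ‖taylorForm F m fun _ => (r : ℂ) • x‖ ≤ ‖f‖ * r ^ m := fun m =>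
    (norm_taylorForm_le f.2.1 (fun x _ => norm_ext_le f x) m _).trans (by gcongr)
  have h₂ : ‖F ((r : ℂ) • x) - ∑ m ∈ Finset.range M, taylorForm F m fun _ => (r : ℂ) • x‖ ≤
      ε / 3 := by
    have hs := hasSum_taylorForm f.2.1 (mem_ball_zero_iff.1 hrx')
    have e := hs.summable.sum_add_tsum_nat_add M
    rw [hs.tsum_eq] at e
    rw [← hF] at e
    rw [← e, add_sub_cancel_left]
    exact (tsum_of_norm_bounded ((summable_nat_add_iff M).2 hsum).hasSum
      fun m => hT (m + M)).trans hM.le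
  have h₃ : ‖(∑ m ∈ Finset.range M, taylorForm F m fun _ => (r : ℂ) • x) -
      ∑ m ∈ Finset.range M, (r : ℂ) ^ m * taylorForm F m fun _ => proj N x‖ ≤ ε / 3 := by
    rw [← Finset.sum_sub_distrib]
    have hb : ∀ m ∈ Finset.range M, ‖(taylorForm F m fun _ => (r : ℂ) • x) -
        (r : ℂ) ^ m * taylorForm F m fun _ => proj N x‖ ≤ ε / 3 / (M + 1) := by
      intro m hm
      have e : (taylorForm F m fun _ => (r : ℂ) • x) -
          (r : ℂ) ^ m * (taylorForm F m fun _ => proj N x) = (taylorForm F m -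
          (taylorForm F m).compContinuousLinearMap fun _ => proj N) fun _ => (r : ℂ) • x := by
        have e' := (taylorForm F m).map_smul_univ (fun _ => (r : ℂ)) fun _ => proj N x
        rw [Finset.prod_const, Finset.card_fin, smul_eq_mul] at e'
        rw [← e']
        simp
      rw [e]
      refine (ContinuousMultilinearMap.le_opNorm _ _).trans ?_
      refine (mul_le_of_le_one_right (norm_nonneg _) ?_).trans (hN m hm).le
      exact Finset.prod_le_one (fun _ _ => norm_nonneg _) fun _ _ => hrx.trans hr₁.le
    refine (norm_sum_le_of_le _ hb).trans ?_
    rw [Finset.sum_const, Finset.card_range, nsmul_eq_mul, mul_div_assoc',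
      div_le_iff₀ (by positivity)]
    nlinarith
  have e : F x - ∑ m ∈ Finset.range M, (r : ℂ) ^ m * (taylorForm F m fun _ => proj N x) =
      (F x - F ((r : ℂ) • x)) +
      (F ((r : ℂ) • x) - ∑ m ∈ Finset.range M, taylorForm F m fun _ => (r : ℂ) • x) +
      ((∑ m ∈ Finset.range M, taylorForm F m fun _ => (r : ℂ) • x) -
        ∑ m ∈ Finset.range M, (r : ℂ) ^ m * taylorForm F m fun _ => proj N x) := by
    ring
  rw [e]
  refine (norm_add₃_le).trans ?_
  linarith

/-- A point of the spectrum of `𝒜ᵤ(B_{c₀})` is determined by its values at the coordinates. -/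
theorem spec_ext {φ ψ : Spec C₀(ℕ, ℂ)}
    (h : ∀ n, φ (coordComp n idAu) = ψ (coordComp n idAu)) (f : Au C₀(ℕ, ℂ)) : φ f = ψ f := by
  refine eq_of_norm_sub_le_zero (le_of_forall_pos_le_add fun ε hε => ?_)
  obtain ⟨M, N, r, hp⟩ := exists_poly_approx f (half_pos hε)
  set p := ∑ m ∈ Finset.range M,
    r ^ m • polyAu (taylorForm (ext (f : ball (0 : C₀(ℕ, ℂ)) 1 →ᵇ ℂ)) m) N
  have hpq : φ p = ψ p := by
    simp only [p, map_sum, map_smul, spec_polyAu, h]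
  have e : φ f - ψ f = φ (f - p) - ψ (f - p) := by
    rw [map_sub, map_sub, hpq]
    ring
  rw [e, zero_add]
  refine (norm_sub_le _ _).trans ?_
  linarith [(norm_spec_apply_le φ (f - p)).trans hp, (norm_spec_apply_le ψ (f - p)).trans hp]

end Coordinates

section Spectrum

variable {X : Type*} [NormedAddCommGroup X] [NormedSpace ℂ X]

theorem norm_spec_le_one {f : Au X} (hf : ‖f‖ ≤ 1) (φ : Spec X) : ‖φ f‖ ≤ 1 :=
  (norm_spec_apply_le φ f).trans hf

theorem le_rho {φ ψ : Spec X} {f : Au X} (hf : ‖f‖ ≤ 1) (h : ψ f = 0) : ‖φ f‖ ≤ rho φ ψ :=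
  le_csSup ⟨1, by rintro _ ⟨g, hg, _, rfl⟩; exact norm_spec_le_one hg φ⟩ ⟨f, hf, h, rfl⟩

theorem rho_le {φ ψ : Spec X} {C : ℝ} (h : ∀ f : Au X, ‖f‖ ≤ 1 → ψ f = 0 → ‖φ f‖ ≤ C) :
    rho φ ψ ≤ C := by
  refine csSup_le ⟨‖φ 0‖, 0, ?_, map_zero ψ, rfl⟩ ?_
  · rw [norm_zero]; exact zero_le_one
  · rintro _ ⟨f, hf, hf', rfl⟩
    exact h f hf hf'

theorem rho_le_one (φ ψ : Spec X) : rho φ ψ ≤ 1 := rho_le fun _ hf _ => norm_spec_le_one hf φ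

theorem norm_sub_le_gleasonDist (φ ψ : Spec X) {f : Au X} (hf : ‖f‖ ≤ 1) :
    ‖φ f - ψ f‖ ≤ gleasonDist φ ψ :=
  ((WeakDual.toStrongDual (φ : WeakDual ℂ (Au X)) -
    WeakDual.toStrongDual (ψ : WeakDual ℂ (Au X))).le_opNorm_of_le hf).trans_eq (mul_one _)

theorem gleasonDist_le {φ ψ : Spec X} {C : ℝ} (hC : 0 ≤ C)
    (h : ∀ f : Au X, ‖f‖ ≤ 1 → ‖φ f - ψ f‖ ≤ C) : gleasonDist φ ψ ≤ C :=
  ContinuousLinearMap.opNorm_le_of_unit_norm hC fun f hf => h f hf.le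

theorem gleasonDist_nonneg (φ ψ : Spec X) : 0 ≤ gleasonDist φ ψ :=
  ContinuousLinearMap.opNorm_nonneg _

theorem gleasonDist_le_two (φ ψ : Spec X) : gleasonDist φ ψ ≤ 2 :=
  gleasonDist_le zero_le_two fun _ hf => (norm_sub_le _ _).trans
    (by linarith [norm_spec_le_one hf φ, norm_spec_le_one hf ψ])

theorem gleasonDist_le_two_mul_rho (φ ψ : Spec X) : gleasonDist φ ψ ≤ 2 * rho φ ψ := by
  have key : ∀ f : Au X, ‖f‖ ≤ 1 → ‖φ f - ψ f‖ ≤ 2 * rho φ ψ := by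
    intro f hf
    let g : Au X := (1 / 2 : ℂ) • (f - ψ f • 1)
    have hval : ∀ χ : Spec X, χ g = 1 / 2 * (χ f - ψ f) := fun χ => by
      simp only [g, map_smul, map_sub, map_one, smul_eq_mul, mul_one]
    have hg : ‖g‖ ≤ 1 := by
      refine norm_le_of_forall_ext_le g zero_le_one fun x hx => ?_
      have e := hval (isChar_ext hx).toSpec
      rw [IsChar.toSpec_apply] at e
      rw [e, norm_mul]
      have b := norm_sub_le ((isChar_ext hx).toSpec f) (ψ f)
      have b₁ := norm_spec_le_one hf (isChar_ext hx).toSpec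
      have b₂ := norm_spec_le_one hf ψ
      norm_num
      linarith
    have h := le_rho (φ := φ) (ψ := ψ) hg (by rw [hval, sub_self, mul_zero])
    rw [hval, norm_mul] at h
    norm_num at h
    linarith
  have h0 : (0 : ℝ) ≤ 2 * rho φ ψ :=
    (norm_nonneg _).trans (key 0 (by rw [norm_zero]; exact zero_le_one))
  exact gleasonDist_le h0 key

/-- The evaluation at a point of the closed disc, as a point of the spectrum. -/
def deltaD (a : closedBall (0 : ℂ) 1) : Spec ℂ := (isChar_evalClosed a.2).toSpec

theorem deltaD_apply (a : closedBall (0 : ℂ) 1) (f : Au ℂ) : deltaD a f = evalClosed f a.1 := rfl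

/-- The evaluation at a point of the closed ball of `ℓ_∞`, as a point of the spectrum. -/
def delta (z : closedBall (0 : ℓ^∞(ℕ, ℂ)) 1) : Spec C₀(ℕ, ℂ) :=
  (isChar_canonicalExtClosed (toBidual_mem_closedBall z.2)).toSpec

theorem delta_apply (z : closedBall (0 : ℓ^∞(ℕ, ℂ)) 1) (f : Au C₀(ℕ, ℂ)) :
    delta z f = canonicalExtClosed f (toBidual z.1) := rfl

theorem delta_coordComp (z : closedBall (0 : ℓ^∞(ℕ, ℂ)) 1) (n : ℕ) (g : Au ℂ) :
    delta z (coordComp n g) = deltaD (coord z n) g := by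
  rw [delta_apply, canonicalExtClosed_coordComp n g (toBidual_mem_closedBall z.2),
    toBidual_coordFun]
  rfl

theorem delta_surjective : Function.Surjective delta := by
  intro φ
  have hb : ∀ n, ‖φ (coordComp n idAu)‖ ≤ 1 := fun n =>
    norm_spec_le_one ((norm_coordComp_le n _).trans norm_idAu_le) φ
  let w : ℓ^∞(ℕ, ℂ) := ⟨fun n => φ (coordComp n idAu),
    memℓp_infty ⟨1, by rintro _ ⟨n, rfl⟩; exact hb n⟩⟩
  have hw : w ∈ closedBall (0 : ℓ^∞(ℕ, ℂ)) 1 :=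
    mem_closedBall_zero_iff.2 (lp.norm_le_of_forall_le zero_le_one hb)
  refine ⟨⟨w, hw⟩, DFunLike.ext _ _ (spec_ext fun n => ?_)⟩
  rw [delta_coordComp, deltaD_apply, evalClosed_idAu (coord ⟨w, hw⟩ n).2]
  rfl

theorem gleasonDist_coord_le (z w : closedBall (0 : ℓ^∞(ℕ, ℂ)) 1) (n : ℕ) :
    gleasonDist (deltaD (coord z n)) (deltaD (coord w n)) ≤ gleasonDist (delta z) (delta w) :=
  gleasonDist_le (gleasonDist_nonneg _ _) fun g hg => by
    rw [← delta_coordComp, ← delta_coordComp]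
    exact norm_sub_le_gleasonDist _ _ ((norm_coordComp_le n g).trans hg)

theorem rho_coord_le (z w : closedBall (0 : ℓ^∞(ℕ, ℂ)) 1) (n : ℕ) :
    rho (deltaD (coord z n)) (deltaD (coord w n)) ≤ rho (delta z) (delta w) :=
  rho_le fun g hg h => by
    rw [← delta_coordComp] at h ⊢
    exact le_rho ((norm_coordComp_le n g).trans hg) h

end Spectrum

section Mobius

/-- The Möbius transformation of the disc that sends `b` to `0`. -/
def mobius (b ζ : ℂ) : ℂ := (ζ - b) / (1 - starRingEnd ℂ b * ζ)

theorem norm_sq_one_sub_conj_mul_sub (b ζ : ℂ) :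
    ‖1 - starRingEnd ℂ b * ζ‖ ^ 2 - ‖ζ - b‖ ^ 2 = (1 - ‖b‖ ^ 2) * (1 - ‖ζ‖ ^ 2) := by
  simp only [← Complex.normSq_eq_norm_sq, Complex.normSq_apply]
  simp
  ring

theorem norm_mobius_le {b ζ : ℂ} (hb : ‖b‖ ≤ 1) (hζ : ‖ζ‖ ≤ 1) : ‖mobius b ζ‖ ≤ 1 := by
  rw [mobius, norm_div]
  refine div_le_one_of_le₀ (abs_le_of_sq_le_sq' ?_ (norm_nonneg _)).2 (norm_nonneg _)
  have := norm_sq_one_sub_conj_mul_sub b ζ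
  nlinarith [mul_nonneg (sub_nonneg.2 (pow_le_one₀ (n := 2) (norm_nonneg b) hb))
    (sub_nonneg.2 (pow_le_one₀ (n := 2) (norm_nonneg ζ) hζ))]

theorem norm_mobius_lt {b ζ : ℂ} (hb : ‖b‖ < 1) (hζ : ‖ζ‖ < 1) : ‖mobius b ζ‖ < 1 := by
  have h := norm_sq_one_sub_conj_mul_sub b ζ
  have h' : 0 < (1 - ‖b‖ ^ 2) * (1 - ‖ζ‖ ^ 2) :=
    mul_pos (sub_pos.2 (pow_lt_one₀ (norm_nonneg b) hb two_ne_zero))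
      (sub_pos.2 (pow_lt_one₀ (norm_nonneg ζ) hζ two_ne_zero))
  have hlt : ‖ζ - b‖ < ‖1 - starRingEnd ℂ b * ζ‖ :=
    lt_of_pow_lt_pow_left₀ 2 (norm_nonneg _) (by linarith)
  rw [mobius, norm_div]
  exact (div_lt_one ((norm_nonneg _).trans_lt hlt)).2 hlt

theorem one_sub_conj_mul_ne_zero {b ζ : ℂ} (h : ‖b‖ * ‖ζ‖ < 1) : 1 - starRingEnd ℂ b * ζ ≠ 0 := by
  intro h0
  have : ‖starRingEnd ℂ b * ζ‖ = 1 := by rw [← sub_eq_zero.1 h0, norm_one]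
  rw [norm_mul, RCLike.norm_conj] at this
  linarith

theorem analyticAt_mobius {b ζ : ℂ} (h : ‖b‖ * ‖ζ‖ < 1) : AnalyticAt ℂ (mobius b) ζ :=
  (analyticAt_id.sub analyticAt_const).div
    (analyticAt_const.sub (analyticAt_const.mul analyticAt_id)) (one_sub_conj_mul_ne_zero h)

theorem mul_norm_lt_one {b ζ : ℂ} (hb : ‖b‖ < 1) (hζ : ‖ζ‖ ≤ 1) : ‖b‖ * ‖ζ‖ < 1 :=
  (mul_le_of_le_one_right (norm_nonneg _) hζ).trans_lt hb

theorem mobius_neg_mobius {b ζ : ℂ} (hb : ‖b‖ < 1) (hζ : ‖ζ‖ ≤ 1) :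
    mobius (-b) (mobius b ζ) = ζ := by
  have h₁ := one_sub_conj_mul_ne_zero (mul_norm_lt_one hb hζ)
  have h₂ := one_sub_conj_mul_ne_zero (mul_norm_lt_one hb hb.le)
  have e₁ : mobius b ζ - -b =
      ζ * (1 - starRingEnd ℂ b * b) / (1 - starRingEnd ℂ b * ζ) := by
    rw [mobius, eq_div_iff h₁, sub_mul, div_mul_cancel₀ _ h₁]
    ring
  have e₂ : 1 - starRingEnd ℂ (-b) * mobius b ζ =
      (1 - starRingEnd ℂ b * b) / (1 - starRingEnd ℂ b * ζ) := by
    rw [mobius, eq_div_iff h₁, sub_mul, map_neg, mul_assoc, div_mul_cancel₀ _ h₁]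
    ring
  rw [mobius, e₁, e₂, div_div_div_cancel_right₀ h₁, mul_div_cancel_right₀ _ h₂]

theorem uniformContinuousOn_ball_of_continuousAt {E : Type*} [NormedAddCommGroup E] {F : ℂ → E}
    (h : ∀ ζ ∈ closedBall (0 : ℂ) 1, ContinuousAt F ζ) : UniformContinuousOn F (ball 0 1) :=
  ((isCompact_closedBall (0 : ℂ) 1).uniformContinuousOn_of_continuous
    fun ζ hζ => (h ζ hζ).continuousWithinAt).mono ball_subset_closedBall

/-- The pseudo-hyperbolic distance of two points of the closed disc, with value zero on the
diagonal. -/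
def pseudoDist (a b : ℂ) : ℝ := ‖(a - b) / (1 - starRingEnd ℂ a * b)‖

theorem pseudoDist_eq_norm_mobius (a b : ℂ) : pseudoDist a b = ‖mobius b a‖ := by
  rw [pseudoDist, mobius, norm_div, norm_div, ← RCLike.norm_conj (1 - starRingEnd ℂ a * b)]
  simp [mul_comm]

theorem pseudoDist_self (a : ℂ) : pseudoDist a a = 0 := by simp [pseudoDist]

theorem pseudoDist_nonneg (a b : ℂ) : 0 ≤ pseudoDist a b := norm_nonneg _

theorem pseudoDist_le_one {a b : ℂ} (ha : ‖a‖ ≤ 1) (hb : ‖b‖ ≤ 1) : pseudoDist a b ≤ 1 := by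
  rw [pseudoDist_eq_norm_mobius]
  exact norm_mobius_le hb ha

theorem pseudoDist_comm (a b : ℂ) : pseudoDist a b = pseudoDist b a := by
  rw [pseudoDist_eq_norm_mobius, pseudoDist, mobius, norm_div, norm_div, norm_sub_rev]

theorem conj_mul_self_of_norm_eq_one {b : ℂ} (hb : ‖b‖ = 1) : starRingEnd ℂ b * b = 1 := by
  rw [mul_comm, Complex.mul_conj, Complex.normSq_eq_norm_sq, hb]; simp

theorem one_sub_conj_mul_of_norm_eq_one {b : ℂ} (hb : ‖b‖ = 1) (a : ℂ) :
    (1 - starRingEnd ℂ b * a) * b = b - a := by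
  linear_combination (-a) * conj_mul_self_of_norm_eq_one hb

theorem mobius_of_norm_eq_one {a b : ℂ} (hb : ‖b‖ = 1) (hab : a ≠ b) : mobius b a = -b := by
  have h := one_sub_conj_mul_of_norm_eq_one hb a
  have h0 : 1 - starRingEnd ℂ b * a ≠ 0 := by
    intro h0
    rw [h0, zero_mul] at h
    exact hab (sub_eq_zero.1 h.symm).symm
  rw [mobius, div_eq_iff h0]
  linear_combination h

theorem pseudoDist_eq_one_right {a b : ℂ} (hb : ‖b‖ = 1) (hab : a ≠ b) : pseudoDist a b = 1 := by
  rw [pseudoDist_eq_norm_mobius, mobius_of_norm_eq_one hb hab, norm_neg, hb]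

theorem pseudoDist_eq_one_left {a b : ℂ} (ha : ‖a‖ = 1) (hab : a ≠ b) : pseudoDist a b = 1 := by
  rw [pseudoDist_comm, pseudoDist_eq_one_right ha hab.symm]

/-- A Möbius transformation as an element of the disc algebra. -/
def mobiusAu (b : ℂ) (hb : ‖b‖ < 1) : Au ℂ :=
  mkAu (mobius b)
    (fun _ hζ => analyticAt_mobius (mul_norm_lt_one hb (mem_ball_zero_iff.1 hζ).le))
    (uniformContinuousOn_ball_of_continuousAt fun _ hζ =>
      (analyticAt_mobius (mul_norm_lt_one hb (mem_closedBall_zero_iff.1 hζ))).continuousAt)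
    1 fun _ hζ => norm_mobius_le hb.le (mem_ball_zero_iff.1 hζ).le

theorem norm_mobiusAu_le (b : ℂ) (hb : ‖b‖ < 1) : ‖mobiusAu b hb‖ ≤ 1 :=
  norm_le_of_forall_ext_le _ zero_le_one fun ζ hζ => by
    refine (congrArg norm (ext_mkAu _ _ _ _ hζ)).trans_le ?_
    exact norm_mobius_le hb.le (mem_ball_zero_iff.1 hζ).le

theorem evalClosed_mobiusAu {b : ℂ} (hb : ‖b‖ < 1) {ζ : ℂ} (hζ : ζ ∈ closedBall (0 : ℂ) 1) :
    evalClosed (mobiusAu b hb) ζ = mobius b ζ :=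
  evalClosed_mkAu _ _ _ _ hζ
    (analyticAt_mobius (mul_norm_lt_one hb (mem_closedBall_zero_iff.1 hζ))).continuousAt

end Mobius

section DiscEstimates

theorem tendsto_norm_mobius_sub {a b : ℂ} (hb : ‖b‖ = 1) (hab : a ≠ b) :
    Tendsto (fun r : ℝ => ‖mobius ((r : ℂ) * b) a - b‖) (𝓝[Set.Ioo 0 1] 1) (𝓝 2) := by
  have hne : 1 - starRingEnd ℂ b * a ≠ 0 := by
    intro h0
    have h := one_sub_conj_mul_of_norm_eq_one hb a
    rw [h0, zero_mul] at h
    exact hab (sub_eq_zero.1 h.symm).symm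
  have h₁ : Tendsto (fun r : ℝ => a - (r : ℂ) * b) (𝓝 1) (𝓝 (a - b)) := by
    have : Continuous fun r : ℝ => a - (r : ℂ) * b :=
      continuous_const.sub (Complex.continuous_ofReal.mul continuous_const)
    simpa using this.tendsto 1
  have h₂ : Tendsto (fun r : ℝ => 1 - starRingEnd ℂ ((r : ℂ) * b) * a) (𝓝 1)
      (𝓝 (1 - starRingEnd ℂ b * a)) := by
    have : Continuous fun r : ℝ => 1 - starRingEnd ℂ ((r : ℂ) * b) * a :=
      continuous_const.sub ((Complex.continuous_conj.comp
        (Complex.continuous_ofReal.mul continuous_const)).mul continuous_const)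
    simpa using this.tendsto 1
  have h := ((h₁.div h₂ hne).sub_const b).norm
  have e : ‖(a - b) / (1 - starRingEnd ℂ b * a) - b‖ = 2 := by
    change ‖mobius b a - b‖ = 2
    rw [mobius_of_norm_eq_one hb hab, ← neg_add', norm_neg, ← two_mul, norm_mul, hb]
    norm_num
  rw [e] at h
  exact h.mono_left nhdsWithin_le_nhds

theorem mobius_real_mul_self {b : ℂ} (hb : ‖b‖ = 1) {r : ℝ} (hrb : ‖(r : ℂ) * b‖ < 1) :
    mobius ((r : ℂ) * b) b = b := by
  rw [mobius, div_eq_iff (one_sub_conj_mul_ne_zero (mul_norm_lt_one hrb hb.le)), map_mul,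
    Complex.conj_ofReal]
  linear_combination (r * b : ℂ) * conj_mul_self_of_norm_eq_one hb

theorem two_le_gleasonDist_deltaD {a b : closedBall (0 : ℂ) 1} (hb : ‖(b : ℂ)‖ = 1)
    (hab : (a : ℂ) ≠ b) : 2 ≤ gleasonDist (deltaD a) (deltaD b) := by
  refine le_of_tendsto (tendsto_norm_mobius_sub hb hab) ?_
  filter_upwards [self_mem_nhdsWithin] with r hr
  have hrb : ‖(r : ℂ) * b‖ < 1 := by
    rw [norm_mul, hb, mul_one, Complex.norm_real, Real.norm_of_nonneg hr.1.le]
    exact hr.2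
  have h := norm_sub_le_gleasonDist (deltaD a) (deltaD b) (norm_mobiusAu_le _ hrb)
  rw [deltaD_apply, deltaD_apply, evalClosed_mobiusAu hrb a.2, evalClosed_mobiusAu hrb b.2] at h
  rwa [mobius_real_mul_self hb hrb] at h

theorem pseudoDist_le_rho (a b : closedBall (0 : ℂ) 1) :
    pseudoDist a b ≤ rho (deltaD a) (deltaD b) := by
  have hb' := mem_closedBall_zero_iff.1 b.2
  rcases hb'.lt_or_eq with hb | hb
  · have h := le_rho (φ := deltaD a) (ψ := deltaD b) (norm_mobiusAu_le (b : ℂ) hb) (by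
      rw [deltaD_apply, evalClosed_mobiusAu hb b.2, mobius, sub_self, zero_div])
    rwa [deltaD_apply, evalClosed_mobiusAu hb a.2, ← pseudoDist_eq_norm_mobius] at h
  · by_cases hab : (a : ℂ) = b
    · rw [hab, pseudoDist_self]
      exact (norm_nonneg _).trans (le_rho (φ := deltaD a) (ψ := deltaD b) (f := 0)
        (by rw [norm_zero]; exact zero_le_one) (map_zero _))
    · linarith [two_le_gleasonDist_deltaD hb hab, gleasonDist_le_two_mul_rho (deltaD a) (deltaD b),
        pseudoDist_le_one (mem_closedBall_zero_iff.1 a.2) hb']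

/-- The Gleason distance of `a` and `b` dominates that of `pseudoDist a b` and `0`. -/
theorem norm_evalClosed_sub_le_gleasonDist (a b : closedBall (0 : ℂ) 1) {g : Au ℂ}
    (hg : ‖g‖ ≤ 1) :
    ‖evalClosed g (pseudoDist a b) - evalClosed g 0‖ ≤ gleasonDist (deltaD a) (deltaD b) := by
  have ha' := mem_closedBall_zero_iff.1 a.2
  have hb' := mem_closedBall_zero_iff.1 b.2
  by_cases hab : (a : ℂ) = b
  · rw [hab, pseudoDist_self]
    simpa using gleasonDist_nonneg _ _
  rcases hb'.lt_or_eq with hb | hb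
  · obtain ⟨u, hu, hu'⟩ : ∃ u : ℂ, ‖u‖ = 1 ∧ u * mobius b a = pseudoDist a b := by
      by_cases h : mobius (b : ℂ) a = 0
      · exact ⟨1, by simp, by simp [pseudoDist_eq_norm_mobius, h]⟩
      · refine ⟨‖mobius (b : ℂ) a‖ / mobius (b : ℂ) a, ?_, ?_⟩
        · rw [norm_div, Complex.norm_real, norm_norm, div_self (norm_ne_zero_iff.2 h)]
        · rw [div_mul_cancel₀ _ h, pseudoDist_eq_norm_mobius]
    have hc : ∀ ζ ∈ closedBall (0 : ℂ) 1, AnalyticAt ℂ (fun ζ => u * mobius b ζ) ζ := fun ζ hζ =>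
      analyticAt_const.mul (analyticAt_mobius (mul_norm_lt_one hb (mem_closedBall_zero_iff.1 hζ)))
    let h : Au ℂ := compAu g (fun ζ => u * mobius b ζ)
      (fun ζ hζ => hc ζ (ball_subset_closedBall hζ))
      (fun ζ hζ => by
        rw [mem_ball_zero_iff, norm_mul, hu, one_mul]
        exact norm_mobius_lt hb (mem_ball_zero_iff.1 hζ))
      (uniformContinuousOn_ball_of_continuousAt fun ζ hζ => (hc ζ hζ).continuousAt)
    have hval : ∀ c : closedBall (0 : ℂ) 1, deltaD c h = evalClosed g (u * mobius b c) := fun c =>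
      evalClosed_compAu c.2 (hc c c.2).continuousAt (by
        rw [mem_closedBall_zero_iff, norm_mul, hu, one_mul]
        exact norm_mobius_le hb' (mem_closedBall_zero_iff.1 c.2))
    have hfin := norm_sub_le_gleasonDist (deltaD a) (deltaD b) (f := h)
      (norm_compAu_le.trans hg)
    have hb0 : mobius (b : ℂ) b = 0 := by rw [mobius, sub_self, zero_div]
    rwa [hval, hval, hu', hb0, mul_zero] at hfin
  · refine le_trans ?_ (two_le_gleasonDist_deltaD hb hab)
    have hs : (pseudoDist a b : ℂ) ∈ closedBall (0 : ℂ) 1 := by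
      rw [mem_closedBall_zero_iff, Complex.norm_real, Real.norm_of_nonneg (pseudoDist_nonneg _ _)]
      exact pseudoDist_le_one ha' hb'
    have h₁ := norm_spec_le_one hg (deltaD ⟨_, hs⟩)
    have h₂ := norm_spec_le_one hg (deltaD ⟨0, by simp⟩)
    rw [deltaD_apply] at h₁ h₂
    exact (norm_sub_le _ _).trans (by linarith)

theorem continuousOn_evalClosed (g : Au ℂ) : ContinuousOn (evalClosed g) (closedBall 0 1) :=
  continuousOn_extendFrom (closure_ball (0 : ℂ) one_ne_zero).ge fun _ ha =>
    ⟨_, tendsto_evalClosed g ha⟩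

/-- An estimate for the values at points of `[0, 1]` passes to the supremum of the points. -/
theorem norm_evalClosed_iSup_sub_le {s : ℕ → ℝ} (h₀ : ∀ n, 0 ≤ s n) (h₁ : ∀ n, s n ≤ 1)
    (g : Au ℂ) {G : ℝ} (h : ∀ n, ‖evalClosed g (s n) - evalClosed g 0‖ ≤ G) :
    ‖evalClosed g ((⨆ n, s n : ℝ) : ℂ) - evalClosed g 0‖ ≤ G := by
  have hmaps : Set.MapsTo (fun t : ℝ => (t : ℂ)) (Set.Icc 0 1) (closedBall 0 1) := fun t ht => by
    rw [mem_closedBall_zero_iff, Complex.norm_real, Real.norm_of_nonneg ht.1]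
    exact ht.2
  have hc : ContinuousOn (fun t : ℝ => ‖evalClosed g t - evalClosed g 0‖) (Set.Icc 0 1) :=
    (((continuousOn_evalClosed g).comp Complex.continuous_ofReal.continuousOn hmaps).sub
      continuousOn_const).norm
  have hcl : IsClosed (Set.Icc (0 : ℝ) 1 ∩
      (fun t : ℝ => ‖evalClosed g t - evalClosed g 0‖) ⁻¹' Set.Iic G) :=
    hc.preimage_isClosed_of_isClosed isClosed_Icc isClosed_Iic
  have hmem : (⨆ n, s n) ∈ closure (Set.range s) :=
    csSup_mem_closure (Set.range_nonempty s) ⟨1, by rintro _ ⟨n, rfl⟩; exact h₁ n⟩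
  have hsub : Set.range s ⊆ Set.Icc (0 : ℝ) 1 ∩
      (fun t : ℝ => ‖evalClosed g t - evalClosed g 0‖) ⁻¹' Set.Iic G := by
    rintro _ ⟨n, rfl⟩
    exact ⟨⟨h₀ n, h₁ n⟩, h n⟩
  exact (hcl.closure_subset_iff.2 hsub hmem).2

/-- A consequence of the Schwarz lemma. -/
theorem norm_ext_sub_le_mul {g : Au ℂ} (hg : ‖g‖ ≤ 1) {s : ℝ} (h₀ : 0 ≤ s) (h₁ : s < 1) :
    ‖ext (g : ball (0 : ℂ) 1 →ᵇ ℂ) s - ext (g : ball (0 : ℂ) 1 →ᵇ ℂ) 0‖ ≤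
      s * (1 + ‖ext (g : ball (0 : ℂ) 1 →ᵇ ℂ) 0‖) := by
  have hs : (s : ℂ) ∈ ball (0 : ℂ) 1 := by
    rwa [mem_ball_zero_iff, Complex.norm_real, Real.norm_of_nonneg h₀]
  have h := Complex.dist_le_div_mul_dist_of_mapsTo_ball (R₁ := 1) (z := (s : ℂ))
    (R₂ := 1 + ‖ext (g : ball (0 : ℂ) 1 →ᵇ ℂ) 0‖) g.2.1.differentiableOn
    (fun x _ => by
      rw [mem_closedBall, dist_eq_norm]
      refine (norm_sub_le _ _).trans ?_
      linarith [(norm_ext_le g x).trans hg]) hs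
  rwa [dist_eq_norm, dist_zero_right, Complex.norm_real, Real.norm_of_nonneg h₀, div_one,
    mul_comm] at h

end DiscEstimates

section UpperBounds

/-- Two points of the closed disc at pseudo-hyperbolic distance at most `s < 1` lie on an analytic
disc parametrized so that they are the images of `s` and `0`. -/
theorem exists_analytic_disc {a b : ℂ} (ha : ‖a‖ ≤ 1) (hb : ‖b‖ ≤ 1) {s : ℝ} (hs : s < 1)
    (hab : pseudoDist a b ≤ s) :
    ∃ φ : ℂ → ℂ, (∀ ζ ∈ closedBall (0 : ℂ) 1, AnalyticAt ℂ φ ζ) ∧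
      (∀ ζ ∈ closedBall (0 : ℂ) 1, ‖φ ζ‖ ≤ 1) ∧ φ 0 = b ∧ φ s = a := by
  rcases hb.lt_or_eq with hb | hb
  · have hs₀ : 0 ≤ s := (pseudoDist_nonneg a b).trans hab
    let c : ℂ := mobius b a / s
    have hc : ‖c‖ ≤ 1 := by
      rw [norm_div, Complex.norm_real, Real.norm_of_nonneg hs₀, ← pseudoDist_eq_norm_mobius]
      exact div_le_one_of_le₀ hab hs₀
    have hcs : c * s = mobius b a := by
      rcases hs₀.eq_or_lt with rfl | h
      · have : mobius b a = 0 := by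
          rw [← norm_le_zero_iff, ← pseudoDist_eq_norm_mobius]
          exact hab
        rw [this, Complex.ofReal_zero, mul_zero]
      · exact div_mul_cancel₀ _ (Complex.ofReal_ne_zero.2 h.ne')
    have hcζ : ∀ ζ ∈ closedBall (0 : ℂ) 1, ‖c * ζ‖ ≤ 1 := fun ζ hζ => by
      rw [norm_mul]
      exact mul_le_one₀ hc (norm_nonneg _) (mem_closedBall_zero_iff.1 hζ)
    have hb' : ‖-b‖ < 1 := by rwa [norm_neg]
    refine ⟨fun ζ => mobius (-b) (c * ζ), fun ζ hζ => ?_, fun ζ hζ =>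
      norm_mobius_le hb'.le (hcζ ζ hζ), ?_, ?_⟩
    · exact (analyticAt_mobius (mul_norm_lt_one hb' (hcζ ζ hζ))).fun_comp
        (analyticAt_const.mul analyticAt_id)
    · simp [mobius]
    · change mobius (-b) (c * s) = a
      rw [hcs, mobius_neg_mobius hb ha]
  · have : a = b := by
      by_contra h
      linarith [pseudoDist_eq_one_right hb h]
    exact ⟨fun _ => b, fun _ _ => analyticAt_const, fun _ _ => hb.le, rfl, this.symm⟩

theorem exists_discAlgebra_interpolation (z w : closedBall (0 : ℓ^∞(ℕ, ℂ)) 1) {s : ℝ}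
    (hs₀ : 0 ≤ s) (hs : s < 1) (hzw : ∀ n, pseudoDist (z.1 n) (w.1 n) ≤ s) (f : Au C₀(ℕ, ℂ))
    {r : ℝ} (hr : r ∈ Set.Ioo (0 : ℝ) 1) (N : ℕ) :
    ∃ g : Au ℂ, ‖g‖ ≤ ‖f‖ ∧
      ext (g : ball (0 : ℂ) 1 →ᵇ ℂ) s =
        ext (f : ball (0 : C₀(ℕ, ℂ)) 1 →ᵇ ℂ) ((r : ℂ) • trunc N (toBidual z.1)) ∧
      ext (g : ball (0 : ℂ) 1 →ᵇ ℂ) 0 =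
        ext (f : ball (0 : C₀(ℕ, ℂ)) 1 →ᵇ ℂ) ((r : ℂ) • trunc N (toBidual w.1)) := by
  have hex := fun n => exists_analytic_disc (mem_closedBall_zero_iff.1 (coord z n).2)
    (mem_closedBall_zero_iff.1 (coord w n).2) hs (hzw n)
  choose φ hφ hφ₁ hφ₀ hφs using hex
  let Φ : ℂ → C₀(ℕ, ℂ) := fun t => (r : ℂ) • ∑ n ∈ Finset.range N, φ n t • unitVec n
  have hΦ : ∀ t ∈ closedBall (0 : ℂ) 1, AnalyticAt ℂ Φ t := fun t ht =>
    analyticAt_const.fun_smul (Finset.analyticAt_fun_sum _ fun n _ =>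
      (hφ n t ht).fun_smul analyticAt_const)
  have hm : Set.MapsTo Φ (ball 0 1) (ball 0 1) := fun t ht => by
    rw [mem_ball_zero_iff, norm_smul, Complex.norm_real, Real.norm_of_nonneg hr.1.le]
    refine (mul_le_of_le_one_right hr.1.le ?_).trans_lt hr.2
    exact norm_sum_smul_unitVec_le N zero_le_one fun n _ => hφ₁ n t (ball_subset_closedBall ht)
  have hs' : (s : ℂ) ∈ ball (0 : ℂ) 1 := by
    rwa [mem_ball_zero_iff, Complex.norm_real, Real.norm_of_nonneg hs₀]
  refine ⟨compAu f Φ (fun t ht => hΦ t (ball_subset_closedBall ht)) hm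
    (uniformContinuousOn_ball_of_continuousAt fun t ht => (hΦ t ht).continuousAt),
    norm_compAu_le, ?_, ?_⟩
  · refine (ext_compAu hs').trans ?_
    simp only [Φ, hφs, trunc, toBidual_coordFun]
    rfl
  · refine (ext_compAu (mem_ball_self one_pos)).trans ?_
    simp only [Φ, hφ₀, trunc, toBidual_coordFun]
    rfl

variable (z w : closedBall (0 : ℓ^∞(ℕ, ℂ)) 1)

theorem pseudoDist_coord_le_one (n : ℕ) : pseudoDist (z.1 n) (w.1 n) ≤ 1 :=
  pseudoDist_le_one (mem_closedBall_zero_iff.1 (coord z n).2)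
    (mem_closedBall_zero_iff.1 (coord w n).2)

theorem bddAbove_pseudoDist : BddAbove (Set.range fun n => pseudoDist (z.1 n) (w.1 n)) :=
  ⟨1, by rintro _ ⟨n, rfl⟩; exact pseudoDist_coord_le_one z w n⟩

theorem iSup_pseudoDist_nonneg : 0 ≤ ⨆ n, pseudoDist (z.1 n) (w.1 n) :=
  Real.iSup_nonneg fun _ => pseudoDist_nonneg _ _

theorem rho_delta_le : rho (delta z) (delta w) ≤ ⨆ n, pseudoDist (z.1 n) (w.1 n) := by
  set s := ⨆ n, pseudoDist (z.1 n) (w.1 n) with hs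
  have hs₀ : 0 ≤ s := iSup_pseudoDist_nonneg z w
  rcases lt_or_ge s 1 with hs₁ | hs₁
  · refine rho_le fun f hf hw => ?_
    have hK : IsClosed {p : ℂ × ℂ | ‖p.1 - p.2‖ ≤ s * (1 + ‖p.2‖)} :=
      isClosed_le (continuous_fst.sub continuous_snd).norm
        (continuous_const.mul (continuous_const.add continuous_snd.norm))
    have h := canonicalExtClosed_mem_of_isClosed f (toBidual_mem_closedBall z.2)
      (toBidual_mem_closedBall w.2) hK fun r hr N => by
        obtain ⟨g, hg, e₁, e₂⟩ := exists_discAlgebra_interpolation z w hs₀ hs₁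
          (le_ciSup (bddAbove_pseudoDist z w)) f hr N
        have := norm_ext_sub_le_mul (hg.trans hf) hs₀ hs₁
        rwa [e₁, e₂] at this
    rw [delta_apply] at hw ⊢
    rw [hw] at h
    simpa using h
  · exact (rho_le_one _ _).trans hs₁

theorem bddAbove_gleasonDist_coord :
    BddAbove (Set.range fun n => gleasonDist (deltaD (coord z n)) (deltaD (coord w n))) :=
  ⟨2, by rintro _ ⟨n, rfl⟩; exact gleasonDist_le_two _ _⟩

theorem gleasonDist_delta_le : gleasonDist (delta z) (delta w) ≤
    ⨆ n, gleasonDist (deltaD (coord z n)) (deltaD (coord w n)) := by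
  set s := ⨆ n, pseudoDist (z.1 n) (w.1 n) with hs
  set G := ⨆ n, gleasonDist (deltaD (coord z n)) (deltaD (coord w n)) with hG
  have hs₀ : 0 ≤ s := iSup_pseudoDist_nonneg z w
  have hdisc : ∀ g : Au ℂ, ‖g‖ ≤ 1 → ‖evalClosed g s - evalClosed g 0‖ ≤ G := fun g hg =>
    norm_evalClosed_iSup_sub_le (fun _ => pseudoDist_nonneg _ _) (pseudoDist_coord_le_one z w) g
      fun n => (norm_evalClosed_sub_le_gleasonDist (coord z n) (coord w n) hg).trans
        (le_ciSup (bddAbove_gleasonDist_coord z w) n)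
  have hG₀ : 0 ≤ G := Real.iSup_nonneg fun _ => gleasonDist_nonneg _ _
  rcases lt_or_ge s 1 with hs₁ | hs₁
  · refine gleasonDist_le hG₀ fun f hf => ?_
    have hK : IsClosed {p : ℂ × ℂ | ‖p.1 - p.2‖ ≤ G} :=
      isClosed_le (continuous_fst.sub continuous_snd).norm continuous_const
    refine canonicalExtClosed_mem_of_isClosed f (toBidual_mem_closedBall z.2)
      (toBidual_mem_closedBall w.2) hK fun r hr N => ?_
    obtain ⟨g, hg, e₁, e₂⟩ := exists_discAlgebra_interpolation z w hs₀ hs₁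
      (le_ciSup (bddAbove_pseudoDist z w)) f hr N
    have := hdisc g (hg.trans hf)
    rw [evalClosed_of_mem_ball g (mem_ball_self one_pos), evalClosed_of_mem_ball g (by
      rwa [mem_ball_zero_iff, Complex.norm_real, Real.norm_of_nonneg hs₀]), e₁, e₂] at this
    exact this
  · have hs₂ : s = 1 := le_antisymm (ciSup_le (pseudoDist_coord_le_one z w)) hs₁
    refine (gleasonDist_le_two _ _).trans (not_lt.1 fun hlt => ?_)
    obtain ⟨a, ha₀, ha₁⟩ := exists_between (max_lt zero_lt_one (by linarith : G - 1 < 1))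
    have ha : ‖(a : ℂ)‖ < 1 := by
      rwa [Complex.norm_real, Real.norm_of_nonneg ((le_max_left _ _).trans ha₀.le)]
    have h := hdisc _ (norm_mobiusAu_le _ ha)
    have hne : (1 : ℂ) - a ≠ 0 := by
      rw [← Complex.ofReal_one, ← Complex.ofReal_sub, Complex.ofReal_ne_zero]
      linarith
    rw [hs₂, evalClosed_mobiusAu ha (by simp), evalClosed_mobiusAu ha (by simp), mobius, mobius,
      Complex.conj_ofReal, Complex.ofReal_one, mul_one, div_self hne] at h
    have e : (1 : ℂ) - (0 - a) / (1 - a * 0) = ((1 + a : ℝ) : ℂ) := by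
      push_cast
      ring
    rw [e, Complex.norm_real] at h
    linarith [(le_abs_self (1 + a)).trans h, (le_max_right 0 (G - 1)).trans_lt ha₀]

theorem iSup_pseudoDist_ne :
    ⨆ n : {n : ℕ // z.1 n ≠ w.1 n}, pseudoDist (z.1 n) (w.1 n) =
      ⨆ n, pseudoDist (z.1 n) (w.1 n) := by
  refine le_antisymm (Real.iSup_le (fun n => le_ciSup (bddAbove_pseudoDist z w) n.1)
    (iSup_pseudoDist_nonneg z w)) (ciSup_le fun n => ?_)
  by_cases h : z.1 n = w.1 n
  · rw [h, pseudoDist_self]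
    exact Real.iSup_nonneg fun _ => pseudoDist_nonneg _ _
  · exact le_ciSup (f := fun n : {n : ℕ // z.1 n ≠ w.1 n} => pseudoDist (z.1 n) (w.1 n))
      ⟨1, by rintro _ ⟨n, rfl⟩; exact pseudoDist_coord_le_one z w n⟩ ⟨n, h⟩

theorem iSup_pseudoDist_le_iSup_rho : ⨆ n, pseudoDist (z.1 n) (w.1 n) ≤
    ⨆ n, rho (deltaD (coord z n)) (deltaD (coord w n)) :=
  ciSup_mono ⟨1, by rintro _ ⟨n, rfl⟩; exact rho_le_one _ _⟩
    fun n => pseudoDist_le_rho (coord z n) (coord w n)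

theorem iSup_rho_le : ⨆ n, rho (deltaD (coord z n)) (deltaD (coord w n)) ≤
    rho (delta z) (delta w) :=
  ciSup_le (rho_coord_le z w)

theorem rho_delta_eq : rho (delta z) (delta w) = ⨆ n, pseudoDist (z.1 n) (w.1 n) :=
  (rho_delta_le z w).antisymm ((iSup_pseudoDist_le_iSup_rho z w).trans (iSup_rho_le z w))

theorem gleasonPart_delta : gleasonPart (delta z) =
    ⋃ r ∈ Set.Ioo (0 : ℝ) 1, {φ | ∃ w, φ = delta w ∧ ∀ n : ℕ,
      (‖z.1 n‖ = 1 → w.1 n = z.1 n) ∧ (‖z.1 n‖ < 1 → w.1 n ∈ pseudoDisc r (z.1 n))} := by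
  ext φ
  simp only [Set.mem_iUnion, Set.mem_ofPred_eq, gleasonPart, exists_prop]
  constructor
  · intro hφ
    obtain ⟨w, rfl⟩ := delta_surjective φ
    rw [rho_delta_eq] at hφ
    have hle := le_ciSup (bddAbove_pseudoDist z w)
    have h₀ := iSup_pseudoDist_nonneg z w
    set s := ⨆ n, pseudoDist (z.1 n) (w.1 n)
    refine ⟨(1 + s) / 2, ⟨by linarith, by linarith⟩, w, rfl, fun n => ⟨fun hz => ?_, fun hz => ?_⟩⟩
    · by_contra h
      have := hle n
      rw [pseudoDist_eq_one_left hz (Ne.symm h)] at this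
      linarith
    · refine ⟨lt_of_le_of_ne (mem_closedBall_zero_iff.1 (coord w n).2) fun hw => ?_, ?_⟩
      · have := hle n
        rw [pseudoDist_eq_one_right hw fun h => hz.ne ((congrArg norm h).trans hw)] at this
        linarith
      · exact (hle n).trans_lt (by linarith)
  · rintro ⟨r, hr, w, rfl, h⟩
    rw [rho_delta_eq]
    refine (ciSup_le fun n => ?_).trans_lt hr.2
    rcases (mem_closedBall_zero_iff.1 (coord z n).2).lt_or_eq with hz | hz
    · exact ((h n).2 hz).2.le
    · rw [(h n).1 hz, pseudoDist_self]
      exact hr.1.le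

end UpperBounds

end GleasonC0

end

theorem mainTheorem1 :
    ∃ (δ : Metric.closedBall (0 : lp (fun _ : ℕ => ℂ) ⊤) 1 → GleasonC0.Spec C₀(ℕ, ℂ))
      (δD : Metric.closedBall (0 : ℂ) 1 → GleasonC0.Spec ℂ),
      -- `δ z` is evaluation at `z` of the canonical extension to the closed ball of `ℓ_∞ = c₀**`
      (∀ z f, δ z f = GleasonC0.canonicalExtClosed f (GleasonC0.toBidual z.1)) ∧
      -- `δD a` is evaluation at the point `a` of the closed disc
      (∀ a f, δD a f = GleasonC0.evalClosed f a.1) ∧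
      (∀ z w, GleasonC0.gleasonDist (δ z) (δ w) =
        ⨆ n : ℕ, GleasonC0.gleasonDist (δD (GleasonC0.coord z n)) (δD (GleasonC0.coord w n))) ∧
      (∀ z w, GleasonC0.rho (δ z) (δ w) =
        ⨆ n : ℕ, GleasonC0.rho (δD (GleasonC0.coord z n)) (δD (GleasonC0.coord w n))) ∧
      (∀ z w, GleasonC0.rho (δ z) (δ w) =
        ⨆ n : {n : ℕ // z.1 n ≠ w.1 n},
          ‖(z.1 n - w.1 n) / (1 - starRingEnd ℂ (z.1 n) * w.1 n)‖) ∧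
      (∀ z, GleasonC0.gleasonPart (δ z) =
        ⋃ r ∈ Set.Ioo (0 : ℝ) 1, {φ | ∃ w, φ = δ w ∧ ∀ n : ℕ,
          (‖z.1 n‖ = 1 → w.1 n = z.1 n) ∧
          (‖z.1 n‖ < 1 → w.1 n ∈ GleasonC0.pseudoDisc r (z.1 n))}) :=
  ⟨GleasonC0.delta, GleasonC0.deltaD, GleasonC0.delta_apply, GleasonC0.deltaD_apply,
    fun z w => (GleasonC0.gleasonDist_delta_le z w).antisymm
      (ciSup_le (GleasonC0.gleasonDist_coord_le z w)),
    fun z w => ((GleasonC0.rho_delta_le z w).trans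
      (GleasonC0.iSup_pseudoDist_le_iSup_rho z w)).antisymm (GleasonC0.iSup_rho_le z w),
    fun z w => (GleasonC0.rho_delta_eq z w).trans (GleasonC0.iSup_pseudoDist_ne z w).symm,
    GleasonC0.gleasonPart_delta⟩
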